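/- **Model.** Fix \(\mu,\xi\in(0,1)\) and a search cost \(s\) with \(0\le s<\xi\). For \(m\in(0,1)\) let \(\mathcal M(m)\) be the set of probability distributions on \([0,1]\) with mean \(m\). A selling strategy is a pair \((p,H)\in[0,1]\times\mathcal M(\mu)\) (a price and a distribution of the buyer's posterior \(w\)). For \(G\in\mathcal M(\xi)\) put \(S_G(t)=\mathbb E_G[\max\{t,v\}]-t\). With \(w\sim H\) and \(v\sim G\) independent, the buyer eventually buys if and only if \(S_G(w-p)\le s\) (she buys without search) or \(w-p>v\) (she returns after search). The revenue is \[\Pi(p,H\mid G)=p\cdot\Pr\big(S_G(w-p)\le s\ \text{ or }\ w-p>v\big),\] and the revenue guarantee of \((p,H)\) is \(\inf_{G\in\mathcal M(\xi)}\Pi(p,H\mid G)\). The strategy \((p,H)\) is *robustly optimal* if this infimum is attained at \((p,H)\) and no strategy in \([0,1]\times\mathcal M(\mu)\) has a larger revenue guarantee. Saying that an information policy is optimal with robust price \(p\) means that the pair of that price and that posterior distribution is robustly optimal. **Notation.** Let \(p^{**}=s/\xi\), \(\underline\mu=\frac{2-\xi+s-\sqrt{2(\xi-s)-(\xi-s)^2}}{2(1-\xi+s)}\),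 \(\bar\mu=1-\frac{\sqrt{\xi-s}}{2}\), and \[p^*=\begin{cases}\frac{1-\sqrt{2(\xi-s)-(\xi-s)^2}}{1-\xi+s}&\mu\le\underline\mu,\\ 2\mu-1&\underline\mu<\mu\le\bar\mu,\\ 1-\sqrt{\xi-s}&\mu>\bar\mu.\end{cases}\] * *Uniform information*: the uniform distribution on \([2\mu-1,1]\) if \(\mu>\bar\mu\); if \(\mu\le\bar\mu\), the distribution with an atom of mass \(1-\frac{2\mu}{1+p^*}\) at \(0\) and constant density \(\frac{2\mu}{1-(p^*)^2}\) on \([p^*,1]\). * *Full information*: mass \(1-\mu\) at \(0\) and mass \(\mu\) at \(1\). * *Mixture information*: constant density \(\frac{2\xi^2(1-\mu)}{(\xi-s)^2}\) on \([s/\xi,1]\) and the remaining mass \(1-\frac{2\xi(1-\mu)}{\xi-s}\) as an atom at \(1\). Let \(B_1(\xi)=\frac{\xi(\xi-1)^2}{\xi^2+1}\), \(B_2(\xi)=\frac{\xi(\xi-1)^2}{(\xi+1)^2}\), \(B_3(\xi)=\xi-2\xi^2\). **Theorem.** Let \(\xi\in(0,1)\) and \(0\le s<\xi\). * If \(s\ge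 B_1(\xi)\), then for every \(\mu\in(0,1)\) full information is optimal, with robust price \(p^{**}=s/\xi\). * If \(s<B_2(\xi)\), then for every \(\mu\in(0,1)\) uniform information is optimal, with robust price \(p^*>s/\xi\). * If \(B_2(\xi)\le s<B_1(\xi)\), there are two cases. 1. If \(s\ge B_3(\xi)\), there is \(\hat\mu\in(0,1]\), depending only on \(\xi\) and \(s\), with \(\hat\mu<1\) when \(s>B_2(\xi)\), such that for all \(\mu\in(0,1)\): if \(\mu<\hat\mu\), uniform information is optimal with robust price \(p^*>s/\xi\); if \(\mu\ge\hat\mu\), full information is optimal with robust price \(p^{**}=s/\xi\). 2. If \(s<B_3(\xi)\), there is \(\check\mu\in(0,1]\), depending only on \(\xi\) and \(s\), with \(\check\mu<1\) when \(s>B_2(\xi)\), such that for all \(\mu\in(0,1)\): if \(\mu<\check\mu\), uniform information is optimal with robust price \(p^*>s/\xi\); if \(\mu\ge\check\mu\), mixture information is optimal with robust price \(p^{**}=s/\xi\). -/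

import Mathlib

open MeasureTheory Set

noncomputable section

namespace RobustSelling

/-- `meanDist m` is the set of all probability distributions on `[0,1]` with mean `m`,
represented as Borel measures on `ℝ` that give no mass to the complement of `[0,1]`. -/
def meanDist (m : ℝ) : Set (Measure ℝ) :=
  {H | IsProbabilityMeasure H ∧ H (Icc (0 : ℝ) 1)ᶜ = 0 ∧ ∫ x, x ∂H = m}

/-- The expected benefit of search `S_G(t) = E_G[max {t, v}] - t` when the net value of the
seller's product is `t` and the outside option is distributed according to `G`. -/
def searchBenefit (G : Measure ℝ) (t : ℝ) : ℝ :=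
  (∫ v, max t v ∂G) - t

/-- The pairs `(w, v)` (posterior, outside option) at which the buyer eventually buys at price `p`:
she buys without search if the benefit of search does not exceed the search cost `s`, and
otherwise she searches and returns to the seller if and only if `v < w - p`. -/
def purchaseEvent (s p : ℝ) (G : Measure ℝ) : Set (ℝ × ℝ) :=
  {x | searchBenefit G (x.1 - p) ≤ s ∨ x.2 < x.1 - p}

/-- The seller's expected revenue from the selling strategy `(p, H)` under the outside option
distribution `G`: price times probability of eventual purchase (posterior and outside option are
independent). -/
def revenue (s p : ℝ) (H G : Measure ℝ) : ℝ :=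
  p * (H.prod G).real (purchaseEvent s p G)

/-- The revenue guarantee of `(p, H)`: the worst-case revenue over all outside option
distributions on `[0,1]` with mean `ξ`. -/
def revenueGuarantee (ξ s p : ℝ) (H : Measure ℝ) : ℝ :=
  sInf ((fun G => revenue s p H G) '' meanDist ξ)

/-- `(p, H)` is a robustly optimal selling strategy: it is feasible, its worst-case revenue is
attained by some outside option distribution (is a minimum), and no feasible selling strategy has
a larger revenue guarantee. -/
def IsRobustlyOptimal (ξ s μ p : ℝ) (H : Measure ℝ) : Prop :=
  p ∈ Icc (0 : ℝ) 1 ∧ H ∈ meanDist μ ∧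
    (∃ G ∈ meanDist ξ, revenue s p H G = revenueGuarantee ξ s p H) ∧
    ∀ p' ∈ Icc (0 : ℝ) 1, ∀ H' ∈ meanDist μ,
      revenueGuarantee ξ s p' H' ≤ revenueGuarantee ξ s p H

/-- The lower threshold on the prior. -/
def muLow (ξ s : ℝ) : ℝ :=
  (2 - ξ + s - √(2 * (ξ - s) - (ξ - s) ^ 2)) / (2 * (1 - ξ + s))

/-- The upper threshold on the prior. -/
def muHigh (ξ s : ℝ) : ℝ :=
  1 - √(ξ - s) / 2

/-- The price `p*`. -/
def pStar (ξ s μ : ℝ) : ℝ :=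
  if μ ≤ muLow ξ s then (1 - √(2 * (ξ - s) - (ξ - s) ^ 2)) / (1 - ξ + s)
  else if μ ≤ muHigh ξ s then 2 * μ - 1
  else 1 - √(ξ - s)

/-- Uniform information: the uniform distribution on `[2μ-1, 1]` if `μ > 1 - √(ξ-s)/2`; otherwise
an atom of mass `1 - 2μ/(1+p*)` at `0` together with the constant density `2μ/(1-p*²)` on
`[p*, 1]`. -/
def uniformInfo (ξ s μ : ℝ) : Measure ℝ :=
  if 1 - √(ξ - s) / 2 < μ then
    ENNReal.ofReal (1 / (2 - 2 * μ)) • volume.restrict (Icc (2 * μ - 1) 1)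
  else
    ENNReal.ofReal (1 - 2 * μ / (1 + pStar ξ s μ)) • Measure.dirac 0 +
      ENNReal.ofReal (2 * μ / (1 - pStar ξ s μ ^ 2)) • volume.restrict (Icc (pStar ξ s μ) 1)

/-- Full information: mass `1 - μ` at `0` and mass `μ` at `1`. -/
def fullInfo (μ : ℝ) : Measure ℝ :=
  ENNReal.ofReal (1 - μ) • Measure.dirac 0 + ENNReal.ofReal μ • Measure.dirac 1

/-- Mixture information: constant density `2ξ²(1-μ)/(ξ-s)²` on `[s/ξ, 1]`, which has total mass
`2ξ(1-μ)/(ξ-s)`, and the remaining mass at `1`. -/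
def mixtureInfo (ξ s μ : ℝ) : Measure ℝ :=
  ENNReal.ofReal (2 * ξ ^ 2 * (1 - μ) / (ξ - s) ^ 2) • volume.restrict (Icc (s / ξ) 1) +
    ENNReal.ofReal (1 - 2 * ξ * (1 - μ) / (ξ - s)) • Measure.dirac 1

/-- The search cost bound `B₁`. -/
def B1 (ξ : ℝ) : ℝ := ξ * (ξ - 1) ^ 2 / (ξ ^ 2 + 1)

/-- The search cost bound `B₂`. -/
def B2 (ξ : ℝ) : ℝ := ξ * (ξ - 1) ^ 2 / (ξ + 1) ^ 2

/-- The search cost bound `B₃`. -/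
def B3 (ξ : ℝ) : ℝ := ξ - 2 * ξ ^ 2

/-- Uniform information is optimal, with robust price `p* > s/ξ`. -/
def UniformOptimal (ξ s μ : ℝ) : Prop :=
  s / ξ < pStar ξ s μ ∧ IsRobustlyOptimal ξ s μ (pStar ξ s μ) (uniformInfo ξ s μ)

/-- Full information is optimal, with robust price `p** = s/ξ`. -/
def FullOptimal (ξ s μ : ℝ) : Prop :=
  IsRobustlyOptimal ξ s μ (s / ξ) (fullInfo μ)

/-- Mixture information is optimal, with robust price `p** = s/ξ`. -/
def MixtureOptimal (ξ s μ : ℝ) : Prop :=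
  IsRobustlyOptimal ξ s μ (s / ξ) (mixtureInfo ξ s μ)

end RobustSelling

end

namespace RobustSelling

/-! Write `k = ξ - s`. If the reservation value `a` solves `S_G(a) = s`, the buyer buys as soon as
her net value `w - p` exceeds `min v a`. This effective outside option has mean `k`, and `a ≤ 1 -
s/ξ` always (`exists_reservation_value`). Nature in effect chooses a distribution of mean `k`,
subject to a feasibility constraint.

Lower bounds: if the demand facing each effective option `u` is at least `c - d * u`, revenue is at
least `p * (c - d * k)` whatever `G` is (`le_revenue`). Each of the three information policies has
such an affine minorant, and nature attains the bound with effective options `0` and `1 - p`. At the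
price `s/ξ` a posterior of `1` always buys without search, which makes that price special.

Upper bounds: two-point effective options `b < k < a` bound the guarantee of any `(p, H)` by values
of the distribution function `J` of `w - p` (`PairBound`). Averaging over suitable families of pairs
leaves only `J 0` and the integral of `J` from `0` to some `A`. These are expectations of `1{w > p}`
and `min (w - p)⁺ A`, so a majorant affine in `w` gives a bound depending on `H` only through its
mean (`majorant`).

Optimizing over prices leaves two candidates: `uniformValue` for prices above `s/ξ` and
`thresholdValue` for the price `s/ξ`. For high priors the first is concave in `μ` and the second
affine. The first is larger at the left end when `s < B1 ξ`, and the comparison at `μ = 1` is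
decided by `B2`, so there is a single crossing (`exists_crossing`). `B3` decides between full and
mixture information. -/

/-! ### Effective outside options: two-point adversaries and the affine lower bound. -/

/-- The distribution with mass `1 - y` at `b` and mass `y` at `c`. -/
noncomputable def twoPoint (y b c : ℝ) : Measure ℝ :=
  ENNReal.ofReal (1 - y) • Measure.dirac b + ENNReal.ofReal y • Measure.dirac c

theorem lintegral_twoPoint (y b c : ℝ) (f : ℝ → ENNReal) :
    ∫⁻ x, f x ∂twoPoint y b c = ENNReal.ofReal (1 - y) * f b + ENNReal.ofReal y * f c := by
  simp [twoPoint, lintegral_add_measure, lintegral_smul_measure]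

theorem integral_twoPoint {y : ℝ} (hy0 : 0 ≤ y) (hy1 : y ≤ 1) (b c : ℝ) (f : ℝ → ℝ) :
    ∫ x, f x ∂twoPoint y b c = (1 - y) * f b + y * f c := by
  have hi : ∀ d : ℝ, Integrable f (Measure.dirac d) := fun d => integrable_dirac (by simp)
  rw [twoPoint, integral_add_measure ((hi b).smul_measure (by simp))
    ((hi c).smul_measure (by simp)), integral_smul_measure, integral_smul_measure,
    integral_dirac, integral_dirac, ENNReal.toReal_ofReal (by linarith), ENNReal.toReal_ofReal hy0]
  simp

theorem twoPoint_apply_of_mem {y b c : ℝ} {S : Set ℝ} (hS : MeasurableSet S)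
    (hb : b ∈ S) (hc : c ∈ S) : twoPoint y b c Sᶜ = 0 := by
  simp [twoPoint, Measure.dirac_apply' _ hS.compl, hb, hc]

theorem twoPoint_isProbabilityMeasure {y : ℝ} (hy0 : 0 ≤ y) (hy1 : y ≤ 1) (b c : ℝ) :
    IsProbabilityMeasure (twoPoint y b c) := by
  constructor
  have : ENNReal.ofReal (1 - y) + ENNReal.ofReal y = 1 := by
    rw [← ENNReal.ofReal_add (by linarith) hy0]; simp
  simpa [twoPoint] using this

theorem twoPoint_mem_meanDist {y b c m : ℝ} (hy0 : 0 ≤ y) (hy1 : y ≤ 1)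
    (hb : b ∈ Icc (0 : ℝ) 1) (hc : c ∈ Icc (0 : ℝ) 1) (hm : (1 - y) * b + y * c = m) :
    twoPoint y b c ∈ meanDist m :=
  ⟨twoPoint_isProbabilityMeasure hy0 hy1 b c, twoPoint_apply_of_mem measurableSet_Icc hb hc,
    by rw [integral_twoPoint hy0 hy1]; exact hm⟩

/-- Nature's two-point strategy with effective options `b` and `a`. Mean `k = ξ - s` forces mass `y
= (k - b)/(a - b)` on the upper one. Reservation value `a` forces the upper outside option to be `c
= a + s/y`. The hypothesis `hf` is exactly `c ≤ 1`. -/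
theorem exists_outside_option {ξ s p b a : ℝ} (H : Measure ℝ) [IsProbabilityMeasure H]
    (hs0 : 0 ≤ s) (hp : 0 ≤ p) (hb0 : 0 ≤ b) (hbk : b < ξ - s) (hka : ξ - s < a)
    (hf : s * (a - b) ≤ (ξ - s - b) * (1 - a)) :
    ∃ G ∈ meanDist ξ, revenue s p H G * (a - b) ≤
      p * ((a - b) - (ξ - s - b) * H.real (Iio (p + a)) - (a - (ξ - s)) * H.real (Iic (p + b))) := by
  have hab : 0 < a - b := by linarith
  have hkb : 0 < ξ - s - b := by linarith
  set y := (ξ - s - b) / (a - b) with hy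
  set c := a + s * (a - b) / (ξ - s - b) with hc
  have hy0 : 0 < y := div_pos hkb hab
  have hy1 : y ≤ 1 := by rw [hy, div_le_one hab]; linarith
  have hyab : y * (a - b) = ξ - s - b := by rw [hy]; field_simp
  have hyc : y * (c - a) = s := by rw [hy, hc]; field_simp; ring
  have hac : a ≤ c := by
    have : 0 ≤ s * (a - b) / (ξ - s - b) := by positivity
    linarith
  have hc1 : c ≤ 1 := by
    have : s * (a - b) / (ξ - s - b) ≤ 1 - a := by rw [div_le_iff₀ hkb]; linarith
    linarith
  have hG := twoPoint_mem_meanDist (m := ξ) hy0.le hy1 ⟨hb0, by linarith⟩ ⟨by linarith, hc1⟩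
    (show (1 - y) * b + y * c = ξ by linear_combination hyab + hyc)
  refine ⟨twoPoint y b c, hG, ?_⟩
  have := hG.1
  set C : Set (ℝ × ℝ) := {x | x.1 < p + a} ∩ {x | x.1 ≤ p + x.2} with hC
  have hCm : MeasurableSet C :=
    (measurableSet_lt measurable_fst measurable_const).inter
      (measurableSet_le measurable_fst (measurable_snd.const_add p))
  have hsub : purchaseEvent s p (twoPoint y b c) ⊆ Cᶜ := by
    rintro ⟨w, v⟩ hx ⟨h1, h2⟩
    replace h1 : w < p + a := h1
    replace h2 : w ≤ p + v := h2
    rcases hx with hx | hx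
    · simp only [searchBenefit, integral_twoPoint hy0.le hy1] at hx
      have e1 : w - p ≤ max (w - p) b := le_max_left _ _
      have e2 : c ≤ max (w - p) c := le_max_right _ _
      have : 0 < y * (a - (w - p)) := mul_pos hy0 (by linarith)
      nlinarith [mul_le_mul_of_nonneg_left e1 (by linarith : 0 ≤ 1 - y),
        mul_le_mul_of_nonneg_left e2 hy0.le]
    · simp only at hx
      linarith
  have hCv : (H.prod (twoPoint y b c)).real C =
      (1 - y) * H.real (Iic (p + b)) + y * H.real (Iio (p + a)) := by
    rw [measureReal_def, Measure.prod_apply_symm hCm, lintegral_twoPoint]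
    have e1 : (fun w => (w, b)) ⁻¹' C = Iic (p + b) := by
      ext w; simp only [hC, mem_preimage, mem_inter_iff, mem_ofPred_eq, mem_Iic]
      exact ⟨fun h => h.2, fun h => ⟨by linarith, h⟩⟩
    have e2 : (fun w => (w, c)) ⁻¹' C = Iio (p + a) := by
      ext w; simp only [hC, mem_preimage, mem_inter_iff, mem_ofPred_eq, mem_Iio]
      exact ⟨fun h => h.1, fun h => ⟨h, by linarith⟩⟩
    rw [e1, e2, ENNReal.toReal_add (by finiteness) (by finiteness), ENNReal.toReal_mul,
      ENNReal.toReal_mul, ENNReal.toReal_ofReal (by linarith), ENNReal.toReal_ofReal hy0.le]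
    rfl
  have hE : (H.prod (twoPoint y b c)).real (purchaseEvent s p (twoPoint y b c)) ≤
      1 - (H.prod (twoPoint y b c)).real C := by
    rw [← probReal_compl_eq_one_sub hCm]
    exact measureReal_mono hsub
  rw [hCv] at hE
  have h2 : (1 - ((1 - y) * H.real (Iic (p + b)) + y * H.real (Iio (p + a)))) * (a - b) =
      (a - b) - (ξ - s - b) * H.real (Iio (p + a)) - (a - (ξ - s)) * H.real (Iic (p + b)) := by
    linear_combination (H.real (Iic (p + b)) - H.real (Iio (p + a))) * hyab
  rw [← h2, revenue, mul_assoc]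
  exact mul_le_mul_of_nonneg_left (mul_le_mul_of_nonneg_right hE hab.le) hp

theorem ae_mem_Icc {m : ℝ} {G : Measure ℝ} (hG : G ∈ meanDist m) : ∀ᵐ v ∂G, v ∈ Icc (0 : ℝ) 1 :=
  hG.2.1

theorem integrable_of_continuous {m : ℝ} {G : Measure ℝ} (hG : G ∈ meanDist m) {f : ℝ → ℝ}
    (hf : Continuous f) : Integrable f G := by
  have := hG.1
  obtain ⟨C, hC⟩ := isCompact_Icc.exists_bound_of_continuousOn (s := Icc (0 : ℝ) 1) hf.continuousOn
  exact Integrable.of_bound hf.aestronglyMeasurable C ((ae_mem_Icc hG).mono fun v hv => hC v hv)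

/-- The search benefit is continuous and decreasing, equals `ξ` at `0` and is at most `s` at `1 -
s/ξ`, so it takes the value `s` in between. The mean of `min v a` then follows from `min v a + max v
a = v + a`. -/
theorem exists_reservation_value {ξ s : ℝ} {G : Measure ℝ} (hG : G ∈ meanDist ξ)
    (hξ0 : 0 < ξ) (hs0 : 0 ≤ s) (hsξ : s < ξ) :
    ∃ a ∈ Ioc (0 : ℝ) (1 - s / ξ), ∫ v, min v a ∂G = ξ - s ∧
      ∀ t, a ≤ t → searchBenefit G t ≤ s := by
  have := hG.1
  have hmax : ∀ t, Integrable (fun v => max t v) G := fun t =>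
    integrable_of_continuous hG (by fun_prop)
  have hlip : ∀ x y, |searchBenefit G x + x - (searchBenefit G y + y)| ≤ |x - y| := by
    intro x y
    simp only [searchBenefit, sub_add_cancel]
    rw [← integral_sub (hmax x) (hmax y)]
    refine (norm_integral_le_of_norm_le_const (μ := G) (f := fun v => max x v - max y v)
      (C := |x - y|) (.of_forall fun v => abs_max_sub_max_le_abs x y v)).trans ?_
    simp
  have hcont : Continuous (searchBenefit G) := by
    have : Continuous fun t => searchBenefit G t + t := by
      refine LipschitzWith.continuous (K := 1) (LipschitzWith.of_dist_le_mul fun x y => ?_)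
      simpa [Real.dist_eq] using hlip x y
    exact (this.sub continuous_id).congr fun t => by simp
  have hanti : ∀ x y, x ≤ y → searchBenefit G y ≤ searchBenefit G x := by
    intro x y hxy
    have := (abs_le.1 (hlip x y)).1
    rw [abs_of_nonpos (by linarith)] at this
    linarith
  have h0 : searchBenefit G 0 = ξ := by
    rw [searchBenefit, sub_zero, ← hG.2.2]
    exact integral_congr_ae ((ae_mem_Icc hG).mono fun v hv => max_eq_right hv.1)
  have hq : 0 ≤ 1 - s / ξ := by
    rw [sub_nonneg, div_le_one hξ0]; exact hsξ.le
  have hid : Integrable (fun v : ℝ => v) G := integrable_of_continuous hG continuous_id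
  have h1 : searchBenefit G (1 - s / ξ) ≤ s := by
    -- Chord bound for the convex map `v ↦ max t v` on `[0,1]`: it lies below `t + (1 - t) * v`,
    -- here with `t = 1 - s/ξ`.
    have : ∫ v, max (1 - s / ξ) v ∂G ≤ ∫ v, ((1 - s / ξ) + (s / ξ) * v) ∂G := by
      refine integral_mono_ae (hmax _) (integrable_of_continuous hG (by fun_prop)) ((ae_mem_Icc hG).mono fun v hv => ?_)
      have hsx : 0 ≤ s / ξ := by positivity
      refine max_le ?_ ?_
      · nlinarith [hv.1]
      · nlinarith [hv.2]
    rw [integral_add (integrable_const _) (hid.const_mul _), integral_const_mul, hG.2.2] at this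
    simp only [integral_const, probReal_univ, smul_eq_mul, one_mul] at this
    rw [div_mul_cancel₀ _ hξ0.ne'] at this
    rw [searchBenefit]; linarith
  obtain ⟨a, ha, hSa⟩ := intermediate_value_Icc' hq hcont.continuousOn ⟨h1, by rw [h0]; exact hsξ.le⟩
  refine ⟨a, ⟨lt_of_le_of_ne ha.1 ?_, ha.2⟩, ?_, fun t ht => (hanti a t ht).trans hSa.le⟩
  · rintro rfl; linarith
  · have e : ∀ v : ℝ, min v a = (v + a) - max a v := fun v => by
      rw [max_comm, ← min_add_max v a]; ring
    simp_rw [e]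
    rw [integral_sub (integrable_of_continuous hG (by fun_prop)) (hmax a), integral_add hid (integrable_const a), hG.2.2]
    simp only [searchBenefit] at hSa
    simp only [integral_const, probReal_univ, smul_eq_mul, one_mul]
    linarith

/-- An affine minorant of demand in the effective option integrates to a number depending on `G`
only through the mean `ξ - s` of `min v a`. -/
theorem le_revenue {ξ s p : ℝ} {H G : Measure ℝ} [IsProbabilityMeasure H] (hG : G ∈ meanDist ξ)
    (hξ0 : 0 < ξ) (hs0 : 0 ≤ s) (hsξ : s < ξ) (hp : 0 ≤ p) {c d : ℝ}
    (h : ∀ a ∈ Ioc (0 : ℝ) (1 - s / ξ), ∀ v ∈ Icc (0 : ℝ) 1,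
      c - d * min v a ≤ H.real {w | a ≤ w - p ∨ v < w - p}) :
    p * (c - d * (ξ - s)) ≤ revenue s p H G := by
  have := hG.1
  obtain ⟨a, ha, hmean, hsb⟩ := exists_reservation_value hG hξ0 hs0 hsξ
  set D : Set (ℝ × ℝ) := {x | a ≤ x.1 - p} ∪ {x | x.2 < x.1 - p} with hD
  have hDm : MeasurableSet D :=
    (measurableSet_le measurable_const (measurable_fst.sub_const p)).union
      (measurableSet_lt measurable_snd (measurable_fst.sub_const p))
  have hsub : D ⊆ purchaseEvent s p G := by
    rintro x (hx | hx)
    · exact Or.inl (hsb _ hx)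
    · exact Or.inr hx
  refine mul_le_mul_of_nonneg_left ?_ hp
  refine le_trans ?_ (measureReal_mono hsub)
  have hmin : Integrable (fun v => min v a) G := integrable_of_continuous hG (by fun_prop)
  have hDv : (H.prod G).real D = ∫ v, H.real {w | a ≤ w - p ∨ v < w - p} ∂G := by
    have hm : Measurable fun v => H ((fun w => (w, v)) ⁻¹' D) := measurable_measure_prodMk_right hDm
    rw [measureReal_def, Measure.prod_apply_symm hDm, ← integral_toReal hm.aemeasurable
      (.of_forall fun v => by finiteness)]
    rfl
  have hint : Integrable (fun v => H.real {w | a ≤ w - p ∨ v < w - p}) G := by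
    have hm : Measurable fun v => H.real {w | a ≤ w - p ∨ v < w - p} :=
      (measurable_measure_prodMk_right (μ := H) hDm).ennreal_toReal
    refine Integrable.of_bound hm.aestronglyMeasurable 1 (.of_forall fun v => ?_)
    rw [Real.norm_of_nonneg measureReal_nonneg]
    exact measureReal_le_one
  rw [hDv]
  calc c - d * (ξ - s) = ∫ v, (c - d * min v a) ∂G := by
        rw [integral_sub (by fun_prop) (by fun_prop), integral_const_mul, hmean]; simp
    _ ≤ _ := integral_mono_ae (by fun_prop) hint ((ae_mem_Icc hG).mono fun v hv => h a ha v hv)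

theorem revenue_nonneg {s p : ℝ} (hp : 0 ≤ p) (H G : Measure ℝ) : 0 ≤ revenue s p H G :=
  mul_nonneg hp measureReal_nonneg

theorem revenueGuarantee_le {ξ s p : ℝ} (hp : 0 ≤ p) (H : Measure ℝ) {G : Measure ℝ}
    (hG : G ∈ meanDist ξ) : revenueGuarantee ξ s p H ≤ revenue s p H G :=
  csInf_le ⟨0, by rintro _ ⟨G, -, rfl⟩; exact revenue_nonneg hp H G⟩ ⟨G, hG, rfl⟩

theorem isRobustlyOptimal_of_value {ξ s μ p : ℝ} {H : Measure ℝ} (V : ℝ) (hp : p ∈ Icc (0 : ℝ) 1)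
    (hH : H ∈ meanDist μ) (hlow : ∀ G ∈ meanDist ξ, V ≤ revenue s p H G)
    (hatt : ∃ G ∈ meanDist ξ, revenue s p H G ≤ V)
    (hup : ∀ p' ∈ Icc (0 : ℝ) 1, ∀ H' ∈ meanDist μ, revenueGuarantee ξ s p' H' ≤ V) :
    IsRobustlyOptimal ξ s μ p H := by
  obtain ⟨G, hG, hGV⟩ := hatt
  have hge : V ≤ revenueGuarantee ξ s p H :=
    le_csInf ⟨_, G, hG, rfl⟩ (by rintro _ ⟨G, hG, rfl⟩; exact hlow G hG)
  exact ⟨hp, hH, ⟨G, hG, le_antisymm (hGV.trans hge) (revenueGuarantee_le hp.1 H hG)⟩,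
    fun p' hp' H' hH' => (hup p' hp' H' hH').trans hge⟩

theorem revenueGuarantee_mul_le {ξ s p b a : ℝ} (H : Measure ℝ) [IsProbabilityMeasure H]
    (hs0 : 0 ≤ s) (hp : 0 ≤ p) (hb0 : 0 ≤ b) (hbk : b < ξ - s) (hka : ξ - s < a)
    (hf : s * (a - b) ≤ (ξ - s - b) * (1 - a)) :
    revenueGuarantee ξ s p H * (a - b) ≤
      p * ((a - b) - (ξ - s - b) * H.real (Iio (p + a)) -
        (a - (ξ - s)) * H.real (Iic (p + b))) := by
  obtain ⟨G, hG, h⟩ := exists_outside_option H hs0 hp hb0 hbk hka hf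
  exact (mul_le_mul_of_nonneg_right (revenueGuarantee_le hp H hG) (by linarith)).trans h

/-! ### Averaging the two-point bounds. -/

/-- The bounds on the guarantee `g` obtained from two-point effective outside options `b < a`,
expressed through the distribution function `J` of the net value `w - p`. Here `k = ξ - s`. -/
structure PairBound (k s p g : ℝ) (J : ℝ → ℝ) : Prop where
  mono : Monotone J
  eq_one : ∀ a, 1 ≤ p + a → J a = 1
  price_nonneg : 0 ≤ p
  cost_nonneg : 0 ≤ s
  pair : ∀ b a, 0 ≤ b → b < k → k < a → s * (a - b) ≤ (k - b) * (1 - a) → ContinuousAt J a →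
    g * (a - b) ≤ p * ((a - b) - (k - b) * J a - (a - k) * J b)

/-- The integral of `J` from `0` to `u`. -/
noncomputable def cumul (J : ℝ → ℝ) (u : ℝ) : ℝ := ∫ x in (0 : ℝ)..u, J x

theorem integral_eq_cumul_sub {J : ℝ → ℝ} (hJ : Monotone J) (a b : ℝ) :
    ∫ x in a..b, J x = cumul J b - cumul J a := by
  rw [cumul, cumul, intervalIntegral.integral_interval_sub_left] <;>
  exact hJ.intervalIntegrable

theorem cumul_zero (J : ℝ → ℝ) : cumul J 0 = 0 := by simp [cumul]

/-- The pair bounds hold only where `J` is continuous, since a tie at `a` involves the left limit of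
`J`. A monotone `J` has countably many jumps, so integration ignores them. -/
theorem integral_le_of_ae_continuousAt {f h J : ℝ → ℝ} (hJ : Monotone J) {a b : ℝ} (hab : a ≤ b)
    (hf : IntervalIntegrable f volume a b) (hh : IntervalIntegrable h volume a b)
    (hle : ∀ x ∈ Ioo a b, ContinuousAt J x → f x ≤ h x) :
    ∫ x in a..b, f x ≤ ∫ x in a..b, h x := by
  refine intervalIntegral.integral_mono_ae_restrict hab hf hh ?_
  have h1 : ∀ᵐ x : ℝ, x ∉ {x | ¬ContinuousAt J x} ∪ {a, b} :=
    (hJ.countable_not_continuousAt.union (Set.countable_insert.2 (countable_singleton b))).ae_notMem _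
  rw [Filter.EventuallyLE, ae_restrict_iff' measurableSet_Icc]
  filter_upwards [h1] with x hx hxI
  simp only [mem_union, mem_ofPred_eq, mem_insert_iff, mem_singleton_iff, not_or, not_not] at hx
  exact hle x ⟨lt_of_le_of_ne hxI.1 (Ne.symm hx.2.1), lt_of_le_of_ne hxI.2 hx.2.2⟩ hx.1

namespace PairBound

variable {k s p g : ℝ} {J : ℝ → ℝ}

/-- Since `J` may jump at `A` (an atom of `H` at `1`), the bound is obtained as a limit `a ↓ A`,
along which `J = 1` and is continuous. Strict feasibility leaves room for `a > A`. -/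
theorem boundary (h : PairBound k s p g J) {b A : ℝ} (hb0 : 0 ≤ b) (hbk : b < k) (hkA : k ≤ A)
    (hA : 1 ≤ p + A) (hf : s * (A - b) < (k - b) * (1 - A)) :
    g * (A - b) ≤ p * ((A - k) * (1 - J b)) := by
  have hc : ∀ f : ℝ → ℝ, Continuous f → Filter.Tendsto f (nhdsWithin A (Ioi A)) (nhds (f A)) :=
    fun f hf => hf.continuousAt.tendsto.mono_left nhdsWithin_le_nhds
  refine le_of_tendsto_of_tendsto (hc (fun a => g * (a - b)) (by fun_prop))
    (hc (fun a => p * ((a - k) * (1 - J b))) (by fun_prop)) ?_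
  have h1 : ∀ᶠ a in nhdsWithin A (Ioi A), s * (a - b) - (k - b) * (1 - a) < 0 :=
    (hc (fun a => s * (a - b) - (k - b) * (1 - a)) (by fun_prop)).eventually_lt_const (by linarith)
  filter_upwards [h1, self_mem_nhdsWithin] with a ha haA
  have haA' : A < a := haA
  have hcont : ContinuousAt J a := by
    have : J =ᶠ[nhds a] fun _ => (1 : ℝ) := by
      filter_upwards [Ioi_mem_nhds haA'] with x hx
      exact h.eq_one x (by linarith [show A < x from hx])
    exact continuousAt_const.congr this.symm
  have := h.pair b a hb0 hbk (by linarith) (by linarith) hcont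
  rw [h.eq_one a (by linarith)] at this
  linarith

theorem integral_boundary (h : PairBound k s p g J) {b₁ A : ℝ} (hb0 : 0 ≤ b₁) (hbk : b₁ < k)
    (hkA : k ≤ A) (hA : 1 ≤ p + A) (hf0 : s * A < k * (1 - A))
    (hf : s * (A - b₁) ≤ (k - b₁) * (1 - A)) :
    g * (A * b₁ - b₁ ^ 2 / 2) ≤ p * ((A - k) * (b₁ - cumul J b₁)) := by
  have hi : IntervalIntegrable J volume 0 b₁ := h.mono.intervalIntegrable
  have := integral_le_of_ae_continuousAt (f := fun b => g * (A - b))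
    (h := fun b => p * ((A - k) * (1 - J b))) h.mono hb0
    (Continuous.intervalIntegrable (by fun_prop) _ _)
    (((intervalIntegrable_const.sub hi).const_mul _).const_mul _) fun b hb _ => by
      refine h.boundary hb.1.le (hb.2.trans hbk) hkA hA ?_
      -- The slack in the feasibility constraint is affine in `b`, positive at `0` and nonnegative
      -- at `b₁`, hence positive in between.
      have hpos : 0 < b₁ - b := by linarith [hb.2]
      by_contra hcon
      push Not at hcon
      nlinarith [mul_pos hpos (sub_pos.2 hf0), mul_nonneg hb.1.le (sub_nonneg.2 hf), hb.1, hb.2,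
        mul_nonneg (hb.1.trans hb.2).le (sub_nonneg.2 hcon)]
  simp only [intervalIntegral.integral_const_mul] at this
  rw [intervalIntegral.integral_sub (by simp) (by simp),
    intervalIntegral.integral_sub (by simp) hi] at this
  simpa [cumul, mul_comm A b₁] using this

/-- Average over the pairs `b = k - θ * (a - k)` with `a` running from `k` to `A`. All of them put
the same mass `θ/(1 + θ)` on the upper point, so feasibility is tightest at `a = A`. -/
theorem integral_pair (h : PairBound k s p g J) {θ A : ℝ} (hθ : 0 < θ) (hkA : k ≤ A)
    (hb : 0 ≤ k - θ * (A - k)) (hf : s * (1 + θ) ≤ θ * (1 - A)) :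
    g * ((1 + θ) * (A - k)) ≤ p * ((1 + θ) * (A - k) - θ * (cumul J A - cumul J k) -
      θ⁻¹ * (cumul J k - cumul J (k - θ * (A - k)))) := by
  have hi : IntervalIntegrable J volume k A := h.mono.intervalIntegrable
  have hanti : Antitone fun a => J ((k + θ * k) - θ * a) := fun x y hxy =>
    h.mono (by nlinarith)
  have hi' : IntervalIntegrable (fun a => J ((k + θ * k) - θ * a)) volume k A :=
    hanti.intervalIntegrable
  have := integral_le_of_ae_continuousAt (f := fun _ => g * (1 + θ))
    (h := fun a => p * ((1 + θ) - θ * J a - J ((k + θ * k) - θ * a))) h.mono hkA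
    intervalIntegrable_const
    (((intervalIntegrable_const.sub (hi.const_mul θ)).sub hi').const_mul _) fun a ha hc => by
      have hak : 0 < a - k := by linarith [ha.1]
      have e : (k + θ * k) - θ * a = k - θ * (a - k) := by ring
      have := h.pair (k - θ * (a - k)) a (by nlinarith [ha.2]) (by nlinarith) ha.1 (by
        have : s * (1 + θ) ≤ θ * (1 - a) := by nlinarith [ha.2]
        nlinarith [mul_le_mul_of_nonneg_right this hak.le]) hc
      rw [e]
      refine le_of_mul_le_mul_right ?_ hak
      linarith
  rw [intervalIntegral.integral_const_mul, intervalIntegral.integral_const_mul,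
    intervalIntegral.integral_sub (intervalIntegrable_const.sub (hi.const_mul θ)) hi',
    intervalIntegral.integral_sub intervalIntegrable_const (hi.const_mul θ),
    intervalIntegral.integral_const_mul, intervalIntegral.integral_comp_sub_mul _ hθ.ne',
    integral_eq_cumul_sub h.mono, integral_eq_cumul_sub h.mono,
    show k + θ * k - θ * k = k by ring,
    show k + θ * k - θ * A = k - θ * (A - k) by ring] at this
  simp only [intervalIntegral.integral_const, smul_eq_mul] at this
  linarith

/-- With `X` and `Y` the integrals of `J` above and below `k`, monotonicity gives `Y/θ ≤ (A - k) * J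
k ≤ X`. Hence `θ * X + Y/θ - (X + Y) = (θ - 1) * (X - Y/θ)` is nonnegative, and both integrals may
be given weight one. -/
theorem integral_pair_of_one_le (h : PairBound k s p g J) {θ A : ℝ} (hθ : 1 ≤ θ) (hkA : k ≤ A)
    (hb : 0 ≤ k - θ * (A - k)) (hf : s * (1 + θ) ≤ θ * (1 - A)) :
    g * ((1 + θ) * (A - k)) ≤
      p * ((1 + θ) * (A - k) - (cumul J A - cumul J (k - θ * (A - k)))) := by
  have hθ0 : 0 < θ := by linarith
  refine (h.integral_pair hθ0 hkA hb hf).trans (mul_le_mul_of_nonneg_left ?_ h.price_nonneg)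
  have hX : (A - k) * J k ≤ cumul J A - cumul J k := by
    rw [← integral_eq_cumul_sub h.mono, ← smul_eq_mul, ← intervalIntegral.integral_const]
    exact intervalIntegral.integral_mono_on hkA (by simp) h.mono.intervalIntegrable
      fun x hx => h.mono hx.1
  have hY : cumul J k - cumul J (k - θ * (A - k)) ≤ θ * (A - k) * J k := by
    have hle : k - θ * (A - k) ≤ k := by nlinarith
    rw [← integral_eq_cumul_sub h.mono,
      show θ * (A - k) * J k = ∫ _ in (k - θ * (A - k))..k, J k by
        rw [intervalIntegral.integral_const, smul_eq_mul]; ring]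
    exact intervalIntegral.integral_mono_on hle h.mono.intervalIntegrable (by simp)
      fun x hx => h.mono hx.2
  have hY' : θ⁻¹ * (cumul J k - cumul J (k - θ * (A - k))) ≤ (A - k) * J k := by
    rw [inv_mul_le_iff₀ hθ0]; linarith
  have e : θ * (θ⁻¹ * (cumul J k - cumul J (k - θ * (A - k)))) =
    cumul J k - cumul J (k - θ * (A - k)) := by field_simp
  nlinarith [mul_nonneg (sub_nonneg.2 hθ) (sub_nonneg.2 (hY'.trans hX))]

theorem integral_zero (h : PairBound k s p g J) {A : ℝ} (hk : 0 < k) (hkA : k ≤ A)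
    (hf : s * A ≤ k * (1 - A)) :
    g * ((A ^ 2 - k ^ 2) / 2) ≤
      p * ((A ^ 2 - k ^ 2) / 2 - k * (cumul J A - cumul J k) - (A - k) ^ 2 / 2 * J 0) := by
  have hi : IntervalIntegrable J volume k A := h.mono.intervalIntegrable
  have hid : ∀ c : ℝ, IntervalIntegrable (fun a : ℝ => a - c) volume k A := fun c =>
    Continuous.intervalIntegrable (by fun_prop) _ _
  have := integral_le_of_ae_continuousAt (f := fun a => g * (a - 0))
    (h := fun a => p * ((a - 0) - k * J a - (a - k) * J 0)) h.mono hkA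
    ((hid 0).const_mul g)
    ((((hid 0).sub (hi.const_mul k)).sub ((hid k).mul_const (J 0))).const_mul p) fun a ha hc => by
      have := h.pair 0 a le_rfl hk ha.1 (by
        nlinarith [mul_nonneg h.cost_nonneg (sub_nonneg.2 ha.2.le), ha.2]) hc
      simpa using this
  rw [intervalIntegral.integral_const_mul, intervalIntegral.integral_const_mul,
    intervalIntegral.integral_sub ((hid 0).sub (hi.const_mul k)) ((hid k).mul_const (J 0)),
    intervalIntegral.integral_sub (hid 0) (hi.const_mul k),
    intervalIntegral.integral_const_mul, intervalIntegral.integral_mul_const,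
    integral_eq_cumul_sub h.mono] at this
  have e : ∀ c : ℝ, ∫ a in k..A, (a - c) = (A ^ 2 - k ^ 2) / 2 - (A - k) * c := fun c => by
    rw [intervalIntegral.integral_sub (by simp) (by simp)]; simp
  rw [e, e] at this
  convert this using 2 <;> ring

/-- Mixes two families: pairs shrinking from `(0, A)` to `(k, k)` at the constant ratio `k/(A - k)`,
and pairs with `b = 0` fixed. -/
theorem linear (h : PairBound k s p g J) {A : ℝ} (hk : 0 < k) (hkA : 2 * k ≤ A)
    (hf : s * A ≤ k * (1 - A)) :
    g * A ^ 2 ≤ p * ((A ^ 2 - 2 * k * A) * (1 - J 0) + 2 * k * (A - cumul J A)) := by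
  have hz : 0 < A - k := by linarith
  have h3 := h.integral_zero hk (by linarith) hf
  have e0 : k - k / (A - k) * (A - k) = 0 := by field_simp; ring
  have h2 := h.integral_pair (θ := k / (A - k)) (A := A) (by positivity) (by linarith)
    (by rw [e0]) (by
      have : 1 + k / (A - k) = A / (A - k) := by field_simp; ring
      rw [this, mul_div_assoc', div_mul_eq_mul_div]
      exact div_le_div_of_nonneg_right hf hz.le)
  rw [e0, cumul_zero] at h2
  have hB : (1 + k / (A - k)) * (A - k) = A := by field_simp; ring
  rw [hB] at h2
  set X := cumul J A - cumul J k with hX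
  -- The weights are chosen so that the integrals of `J` over `[0,k]` and `[k,A]` both get
  -- coefficient `2 * k`. The second weight is nonnegative because `A ≥ 2 * k`.
  have hc2 : 0 ≤ 2 * k ^ 2 / (A - k) := by positivity
  have hc3 : 0 ≤ 2 * (1 - k ^ 2 / (A - k) ^ 2) := by
    have : k ^ 2 / (A - k) ^ 2 ≤ 1 := by
      rw [div_le_one (by positivity)]; nlinarith
    linarith
  have key := add_le_add (mul_le_mul_of_nonneg_left h2 hc2) (mul_le_mul_of_nonneg_left h3 hc3)
  have eL : 2 * k ^ 2 / (A - k) * (g * A) +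
      2 * (1 - k ^ 2 / (A - k) ^ 2) * (g * ((A ^ 2 - k ^ 2) / 2)) = g * A ^ 2 := by
    field_simp; ring
  have eR : 2 * k ^ 2 / (A - k) * (p * (A - k / (A - k) * X - (k / (A - k))⁻¹ * (cumul J k - 0))) +
      2 * (1 - k ^ 2 / (A - k) ^ 2) *
        (p * ((A ^ 2 - k ^ 2) / 2 - k * X - (A - k) ^ 2 / 2 * J 0)) =
      p * ((A ^ 2 - 2 * k * A) * (1 - J 0) + 2 * k * (A - cumul J A)) := by
    have : cumul J A = X + cumul J k := by rw [hX]; ring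
    rw [this]
    field_simp; ring
  rwa [eL, eR] at key

end PairBound

/-- For `T = 1 - p` and `b₁ = k - θ * (T - k)`, options in `[0, b₁]` are paired with `T`, while
those in `[b₁, k]` are paired with `[k, T]` at ratio `θ`. Weights `p`, `1` and `T - k` make the
coefficient of `J` constant on `[0, T]` and produce the functional bounded in `majorant_id`. -/
theorem PairBound.combined {k s p g : ℝ} {J : ℝ → ℝ} (h : PairBound k s p g J) {θ T : ℝ}
    (hθ : 1 ≤ θ) (hT : T = 1 - p) (hk : 0 < k) (hkT : k < T)
    (hb : 0 ≤ k - θ * (T - k)) (hf : s * (1 + θ) ≤ θ * p) (hf0 : s * T < k * p) :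
    g * (T * (k - θ * (T - k)) - (k - θ * (T - k)) ^ 2 / 2 + p * T + (1 + θ) * (T - k) ^ 2) ≤
      p * ((T - k) * (p * (1 - J 0) + (T - cumul J T))) := by
  have hz : 0 < T - k := by linarith
  have hpT : 1 - T = p := by linarith
  have hθz : 0 < θ * (T - k) := by positivity
  have h0 := h.boundary (b := 0) (A := T) le_rfl hk hkT.le (by linarith) (by rw [hpT]; simpa using hf0)
  have h1 := h.integral_boundary (b₁ := k - θ * (T - k)) (A := T) hb (by linarith) hkT.le
    (by linarith) (by rw [hpT]; exact hf0) (by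
      rw [hpT]; nlinarith [mul_le_mul_of_nonneg_right hf hz.le])
  have h2 := h.integral_pair_of_one_le hθ hkT.le hb (by rw [hpT]; exact hf)
  have h0' := mul_le_mul_of_nonneg_left h0 h.price_nonneg
  have h2' := mul_le_mul_of_nonneg_left h2 hz.le
  linarith

/-! ### From the distribution function of net values to the mean of the posterior. -/

/-- Layer-cake formula: on `(0, A)` the tail of `min (w - p)⁺ A` at `t` is `1 - J t`. -/
theorem sub_cumul_eq {m : ℝ} {H : Measure ℝ} (hH : H ∈ meanDist m) (p : ℝ) {A : ℝ} (hA : 0 ≤ A) :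
    A - cumul (fun u => H.real (Iic (p + u))) A = ∫ w, min (max (w - p) 0) A ∂H := by
  have := hH.1
  have hmono : Monotone fun u => H.real (Iic (p + u)) := fun x y hxy =>
    measureReal_mono (Iic_subset_Iic.2 (by linarith))
  rw [(integrable_of_continuous hH (by fun_prop : Continuous fun w : ℝ =>
      min (max (w - p) 0) A)).integral_eq_integral_meas_lt
      (.of_forall fun w => le_min (le_max_right _ _) hA)]
  have hsub : ∫ t in Ioi (0 : ℝ), H.real {w | t < min (max (w - p) 0) A} =
      ∫ t in Ioo (0 : ℝ) A, H.real {w | t < min (max (w - p) 0) A} := by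
    refine setIntegral_eq_of_subset_of_forall_sdiff_eq_zero measurableSet_Ioi
      (fun x hx => hx.1) fun t ht => ?_
    have : {w | t < min (max (w - p) 0) A} = ∅ := by
      ext w
      simp only [mem_ofPred_eq, mem_empty_iff_false, iff_false, not_lt]
      have : A ≤ t := by
        by_contra hc
        exact ht.2 ⟨ht.1, not_le.1 hc⟩
      exact (min_le_right _ _).trans this
    rw [this]; simp
  rw [hsub, setIntegral_congr_fun (g := fun t => 1 - H.real (Iic (p + t))) measurableSet_Ioo,
    ← integral_Ioc_eq_integral_Ioo, ← intervalIntegral.integral_of_le hA,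
    intervalIntegral.integral_sub (by simp) hmono.intervalIntegrable]
  · simp [cumul]
  · intro t ht
    have : {w | t < min (max (w - p) 0) A} = (Iic (p + t))ᶜ := by
      ext w
      simp only [mem_ofPred_eq, mem_compl_iff, mem_Iic, not_le, lt_min_iff, lt_max_iff]
      have := ht.1
      have := ht.2
      constructor
      · rintro ⟨h | h, -⟩ <;> linarith
      · intro h; exact ⟨Or.inl (by linarith), ht.2⟩
    simp only [this]
    exact probReal_compl_eq_one_sub measurableSet_Iic

theorem majorant {m : ℝ} {H : Measure ℝ} (hH : H ∈ meanDist m) {p A c d α β : ℝ} (hA : 0 ≤ A)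
    (hle : ∀ w ∈ Icc (0 : ℝ) 1, w ≤ p → 0 ≤ α + β * w)
    (hgt : ∀ w ∈ Icc (0 : ℝ) 1, p < w → c + d * min (w - p) A ≤ α + β * w) :
    c * (1 - H.real (Iic (p + 0))) + d * (A - cumul (fun u => H.real (Iic (p + u))) A) ≤
      α + β * m := by
  have := hH.1
  have hi1 : Integrable (fun w => (Ioi p).indicator (fun _ => c) w) H :=
    (integrable_const c).indicator measurableSet_Ioi
  have hi2 : Integrable (fun w => d * min (max (w - p) 0) A) H :=
    integrable_of_continuous hH (by fun_prop)
  have hi3 : Integrable (fun w => α + β * w) H := integrable_of_continuous hH (by fun_prop)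
  have hid : Integrable (fun w => β * w) H := integrable_of_continuous hH (by fun_prop)
  have hint : ∫ w, ((Ioi p).indicator (fun _ => c) w + d * min (max (w - p) 0) A) ∂H ≤
      ∫ w, (α + β * w) ∂H := by
    refine integral_mono_ae (hi1.add hi2) hi3 ((ae_mem_Icc hH).mono fun w hw => ?_)
    by_cases h : p < w
    · have := hgt w hw h
      simp only [indicator_of_mem (show w ∈ Ioi p from h)]
      rwa [max_eq_left (by linarith)]
    · have := hle w hw (not_lt.1 h)
      simp only [indicator_of_notMem (show w ∉ Ioi p from h)]
      rw [max_eq_right (by linarith), min_eq_left hA]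
      simpa using this
  rw [integral_add hi1 hi2, integral_indicator measurableSet_Ioi, integral_const_mul,
    integral_add (integrable_const _) hid, integral_const_mul, hH.2.2, ← sub_cumul_eq hH p hA] at hint
  have e : H.real (Ioi p) = 1 - H.real (Iic p) := by
    rw [← probReal_compl_eq_one_sub measurableSet_Iic, compl_Iic]
  simp only [integral_const, measureReal_restrict_apply MeasurableSet.univ, univ_inter, e, probReal_univ,
    smul_eq_mul, one_mul] at hint
  rw [add_zero]
  linarith

/-- At a continuity point of `J` the mass of `Iio (p + a)` is no less than that of `Iic (p + a)`, by
letting `x ↑ a`. -/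
theorem pairBound_revenueGuarantee {ξ s μ p : ℝ} {H : Measure ℝ} (hH : H ∈ meanDist μ)
    (hs0 : 0 ≤ s) (hp : 0 ≤ p) :
    PairBound (ξ - s) s p (revenueGuarantee ξ s p H) fun u => H.real (Iic (p + u)) := by
  have := hH.1
  have hmono : Monotone fun u => H.real (Iic (p + u)) := fun x y hxy =>
    measureReal_mono (Iic_subset_Iic.2 (by linarith))
  refine ⟨hmono, fun a ha => ?_, hp, hs0, fun b a hb0 hbk hka hf hc => ?_⟩
  · have : H (Iic (p + a))ᶜ = 0 := measure_mono_null
      (compl_subset_compl.2 fun x hx => by exact hx.2.trans ha) hH.2.1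
    have := (prob_compl_eq_zero_iff measurableSet_Iic).1 this
    simp [measureReal_def, this]
  · refine (revenueGuarantee_mul_le H hs0 hp hb0 hbk hka hf).trans
      (mul_le_mul_of_nonneg_left ?_ hp)
    have : H.real (Iic (p + a)) ≤ H.real (Iio (p + a)) := by
      refine le_of_tendsto (hc.tendsto.mono_left (nhdsWithin_le_nhds (s := Iio a))) ?_
      filter_upwards [self_mem_nhdsWithin] with x hx
      refine measureReal_mono fun w hw => ?_
      have h1 : w ≤ p + x := hw
      have h2 : x < a := hx
      exact show w < p + a by linarith
    nlinarith [mul_le_mul_of_nonneg_left this (by linarith : 0 ≤ ξ - s - b)]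

/-! ### Upper bounds on the guarantee, by range of prices. -/

section UpperBounds

variable {ξ s μ p : ℝ} {H : Measure ℝ}

/-- Uses `A = q = 1 - s/ξ`, the largest reservation value: the pair `(0, q)` is feasible with
equality. The condition `k ≤ 2 * ξ ^ 2` amounts to `q ^ 2 ≤ 2 * k`, which lets a majorant through
the origin suffice. -/
theorem guarantee_le_of_price_le (hH : H ∈ meanDist μ) (hξ0 : 0 < ξ) (hξ1 : ξ < 1) (hs0 : 0 ≤ s)
    (hsξ : s < ξ) (hp : 0 ≤ p) (hp0 : p ≤ s / ξ) (hk : ξ - s ≤ 2 * ξ ^ 2) :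
    revenueGuarantee ξ s p H ≤ s / ξ * μ := by
  have hB := pairBound_revenueGuarantee (ξ := ξ) hH hs0 hp
  set g := revenueGuarantee ξ s p H
  set r := s / ξ with hr
  have hsr : s = r * ξ := by rw [hr]; field_simp
  have hr0 : 0 ≤ r := by positivity
  have hr1 : r < 1 := by rw [hr, div_lt_one hξ0]; exact hsξ
  set q := 1 - r with hq
  set k := ξ - s with hkdef
  have hkq : k = ξ * q := by rw [hkdef, hq, hsr]; ring
  have hq0 : 0 < q := by linarith
  have hk0 : 0 < k := by linarith
  have hq2 : q ^ 2 ≤ 2 * k := by nlinarith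
  have hfeas : s * q = k * (1 - q) := by rw [hkq, hsr, hq]; ring
  have hgap : ∀ w, p < w → p * (r + (w - p)) ≤ r * w := fun w hw => by
    nlinarith [mul_nonneg (sub_nonneg.2 hp0) (sub_nonneg.2 hw.le)]
  have hm : ∀ w, p * (r + min (w - p) q) ≤ p * (r + (w - p)) := fun w =>
    mul_le_mul_of_nonneg_left (by linarith [min_le_left (w - p) q]) hp
  rcases le_or_gt (2 * k) q with h2 | h2
  · have h1 := hB.linear hk0 h2 hfeas.le
    have hmaj := majorant hH (p := p) (A := q) (c := p * (q ^ 2 - 2 * k * q)) (d := p * (2 * k))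
      (α := 0) (β := r * q ^ 2) hq0.le (fun w hw _ => by have := hw.1; positivity) fun w hw hpw => by
        have h3 := min_le_right (w - p) q
        have h4 : q ^ 2 - 2 * k * (q - min (w - p) q) ≤ q ^ 2 * (r + min (w - p) q) := by
          nlinarith [mul_le_mul_of_nonneg_right hq2 (sub_nonneg.2 h3)]
        nlinarith [mul_le_mul_of_nonneg_left h4 hp, mul_le_mul_of_nonneg_left ((hm w).trans
          (hgap w hpw)) (sq_nonneg q)]
    refine le_of_mul_le_mul_right (a := q ^ 2) ?_ (by positivity)
    linarith
  -- Here the ratio `k/(q - k)`, which carries `b` down to `0` exactly when `a` reaches `q`, is at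
  -- least one.
  · have hz : 0 < q - k := by nlinarith
    have e0 : k - k / (q - k) * (q - k) = 0 := by field_simp; ring
    have hBq : (1 + k / (q - k)) * (q - k) = q := by field_simp; ring
    have h1 := hB.integral_pair_of_one_le (θ := k / (q - k)) (A := q)
      (by rw [le_div_iff₀ hz]; linarith) (by linarith) (by rw [e0]) (by
        have : 1 + k / (q - k) = q / (q - k) := by field_simp; ring
        rw [this, mul_div_assoc', div_mul_eq_mul_div, hfeas])
    rw [e0, cumul_zero, hBq] at h1
    have hmaj := majorant hH (p := p) (A := q) (c := 0) (d := p)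
      (α := 0) (β := r * q) hq0.le (fun w hw _ => by have := hw.1; positivity) fun w hw hpw => by
        have h3 := min_le_right (w - p) q
        have h4 : min (w - p) q ≤ q * (r + min (w - p) q) := by
          nlinarith [mul_nonneg hr0 (sub_nonneg.2 h3)]
        nlinarith [mul_le_mul_of_nonneg_left h4 hp, mul_le_mul_of_nonneg_left ((hm w).trans
          (hgap w hpw)) hq0.le]
    refine le_of_mul_le_mul_right (a := q) ?_ hq0
    linarith

/-- Now `2 * k ≤ q ^ 2`, and the affine majorant has the nonnegative intercept `r * (q ^ 2 - 2 *
k)`. This is why the bound is affine but not proportional in `μ`. -/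
theorem guarantee_le_mixture_of_price_le (hH : H ∈ meanDist μ) (hξ0 : 0 < ξ)
    (hs0 : 0 ≤ s) (hsξ : s < ξ) (hp : 0 ≤ p) (hp0 : p ≤ s / ξ)
    (hk : 2 * ξ ^ 2 ≤ ξ - s) :
    revenueGuarantee ξ s p H ≤ s / ξ * (1 - 2 * ξ ^ 2 / (ξ - s) * (1 - μ)) := by
  have hB := pairBound_revenueGuarantee (ξ := ξ) hH hs0 hp
  set g := revenueGuarantee ξ s p H
  set r := s / ξ with hr
  have hsr : s = r * ξ := by rw [hr]; field_simp
  have hr0 : 0 ≤ r := by positivity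
  have hr1 : r < 1 := by rw [hr, div_lt_one hξ0]; exact hsξ
  set q := 1 - r with hq
  set k := ξ - s with hkdef
  have hkq : k = ξ * q := by rw [hkdef, hq, hsr]; ring
  have hq0 : 0 < q := by linarith
  have hk0 : 0 < k := by linarith
  have hq2 : 2 * k ≤ q ^ 2 := by
    rw [hkq] at hk ⊢
    nlinarith
  have hfeas : s * q = k * (1 - q) := by rw [hkq, hsr, hq]; ring
  have h1 := hB.linear hk0 (by nlinarith) hfeas.le
  have hmaj := majorant hH (p := p) (A := q) (c := p * (q ^ 2 - 2 * k * q)) (d := p * (2 * k))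
    (α := r * (q ^ 2 - 2 * k)) (β := r * (2 * k)) hq0.le
    (fun w hw _ => by have := hw.1; have := sub_nonneg.2 hq2; positivity) fun w hw hpw => by
      have h3 : p * (2 * k) * min (w - p) q ≤ p * (2 * k) * (w - p) :=
        mul_le_mul_of_nonneg_left (min_le_left _ _) (by positivity)
      nlinarith [mul_nonneg (sub_nonneg.2 hp0) (sub_nonneg.2 hq2),
        mul_nonneg (mul_nonneg (sub_nonneg.2 hp0) (sub_nonneg.2 hpw.le)) hk0.le]
  refine le_of_mul_le_mul_right (a := q ^ 2) ?_ (by positivity)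
  have e : r * (1 - 2 * ξ ^ 2 / k * (1 - μ)) * q ^ 2 = r * (q ^ 2 - 2 * k) + r * (2 * k) * μ := by
    rw [hkq]; field_simp; ring
  rw [e]
  linarith

/-- With `A ^ 2 = 2 * k` the two coefficients in `linear` become `A ^ 2 * (1 - A)` and `A ^ 2`. For
`p ≤ 1 - A` the line `(1 - A) * w` through the origin is then a majorant. -/
theorem guarantee_le_of_price_le_of_sq_eq (hH : H ∈ meanDist μ)
    (hs0 : 0 ≤ s) (hsξ : s < ξ) (hp : 0 ≤ p) {A : ℝ} (hA0 : 0 < A) (hA1 : A ≤ 1)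
    (hA : A ^ 2 = 2 * (ξ - s)) (hAq : s ≤ ξ * (1 - A)) (hpA : p ≤ 1 - A) :
    revenueGuarantee ξ s p H ≤ (1 - A) * μ := by
  have hB := pairBound_revenueGuarantee (ξ := ξ) hH hs0 hp
  have hk0 : 0 < ξ - s := by linarith
  have h1 := hB.linear hk0 (A := A) (by nlinarith) (by linarith)
  have hmaj := majorant hH (p := p) (A := A) (c := p * (1 - A)) (d := p)
    (α := 0) (β := 1 - A) hA0.le
    (fun w hw _ => by have := hw.1; have := sub_nonneg.2 hA1; positivity) fun w hw hpw => by
      have h3 := mul_le_mul_of_nonneg_left (min_le_left (w - p) A) hp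
      nlinarith [mul_nonneg (sub_nonneg.2 hpA) (sub_nonneg.2 hpw.le)]
  refine le_of_mul_le_mul_right (a := A ^ 2) ?_ (by positivity)
  have := mul_le_mul_of_nonneg_left hmaj (sq_nonneg A)
  refine h1.trans (le_trans (le_of_eq ?_) (this.trans (le_of_eq ?_)))
  · rw [← hA]; ring
  · ring

theorem feasible_of_price_gt (hξ0 : 0 < ξ) (hp0 : s / ξ < p) :
    s * (1 - p) < (ξ - s) * p := by
  rw [div_lt_iff₀ hξ0] at hp0
  linarith

/-- Net values never exceed `1 - p ≤ k`, and an effective option concentrated just above `k` deters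
every type. -/
theorem guarantee_nonpos (hH : H ∈ meanDist μ) (hξ1 : ξ < 1) (hs0 : 0 ≤ s)
    (hsξ : s < ξ) (hp : 0 ≤ p) (hkT : 1 - p ≤ ξ - s) : revenueGuarantee ξ s p H ≤ 0 := by
  have hB := pairBound_revenueGuarantee (ξ := ξ) hH hs0 hp
  have hk0 : 0 < ξ - s := by linarith
  have := hB.boundary (b := 0) (A := ξ - s) le_rfl hk0 le_rfl (by linarith) (by nlinarith)
  rw [sub_zero, sub_self, zero_mul, mul_zero] at this
  exact nonpos_of_mul_nonpos_left this hk0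

theorem guarantee_le_constant (hH : H ∈ meanDist μ) (hξ0 : 0 < ξ) (hs0 : 0 ≤ s)
    (hsξ : s < ξ) (hp0 : s / ξ < p) (hkT : ξ - s < 1 - p) :
    revenueGuarantee ξ s p H ≤ p * (1 - p - (ξ - s)) / (1 - p) := by
  have hp : 0 ≤ p := (by positivity : 0 ≤ s / ξ).trans hp0.le
  have hB := pairBound_revenueGuarantee (ξ := ξ) hH hs0 hp
  have hf := feasible_of_price_gt hξ0 hp0
  have hk0 : 0 < ξ - s := by linarith
  have h0 := hB.boundary (b := 0) (A := 1 - p) le_rfl hk0 hkT.le (by linarith) (by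
    rw [sub_sub_cancel]; simpa using hf)
  rw [le_div_iff₀ (by linarith), ← sub_zero (1 - p)]
  rw [sub_zero] at *
  refine h0.trans (mul_le_mul_of_nonneg_left ?_ hp)
  have : 0 ≤ H.real (Iic (p + 0)) := measureReal_nonneg
  nlinarith

theorem majorant_id (hH : H ∈ meanDist μ) (hp1 : p ≤ 1) :
    p * (1 - H.real (Iic (p + 0))) +
      ((1 - p) - cumul (fun u => H.real (Iic (p + u))) (1 - p)) ≤ μ := by
  have := majorant hH (p := p) (A := 1 - p) (c := p) (d := 1) (α := 0) (β := 1)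
    (by linarith) (fun w hw _ => by linarith [hw.1]) fun w hw hpw => by
      linarith [min_le_left (w - p) (1 - p)]
  linarith

theorem guarantee_le_of_two_mul_le (hH : H ∈ meanDist μ) (hξ0 : 0 < ξ) (hs0 : 0 ≤ s)
    (hsξ : s < ξ) (hp0 : s / ξ < p) (hkT : 2 * (ξ - s) ≤ 1 - p)
    (hT : (1 - p) ^ 2 ≤ 2 * (ξ - s)) :
    revenueGuarantee ξ s p H * (1 - p ^ 2) ≤ 2 * p * (1 - p - (ξ - s)) * μ := by
  have hp : 0 ≤ p := (by positivity : 0 ≤ s / ξ).trans hp0.le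
  have hB := pairBound_revenueGuarantee (ξ := ξ) hH hs0 hp
  have hf := feasible_of_price_gt hξ0 hp0
  have hk0 : 0 < ξ - s := by linarith
  have h0 := hB.boundary (b := 0) (A := 1 - p) le_rfl hk0 (by linarith) (by linarith) (by
    rw [sub_sub_cancel]; simpa using hf)
  have h1 := hB.linear hk0 hkT (by rw [sub_sub_cancel]; exact hf.le)
  have hm := majorant_id (p := p) hH (by linarith)
  set k := ξ - s
  set g := revenueGuarantee ξ s p H
  set J := fun u => H.real (Iic (p + u)) with hJ
  have hJ0 : J 0 = H.real (Iic (p + 0)) := rfl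
  rw [← hJ0] at hm
  have hz : 0 < 1 - p - k := by linarith
  refine le_of_mul_le_mul_left (a := k) ?_ hk0
  -- The weights `2 * k - (1 - p) ^ 2` and `1 - p - k` turn the right side into `2 * k * p * (1 - p
  -- - k)` times the functional of `majorant_id`.
  have h0' := mul_le_mul_of_nonneg_left h0 (sub_nonneg.2 hT)
  have h1' := mul_le_mul_of_nonneg_left h1 hz.le
  have hm' := mul_le_mul_of_nonneg_left hm (by positivity : 0 ≤ 2 * k * p * (1 - p - k))
  linarith

theorem guarantee_mul_le_of_lt_two_mul (hH : H ∈ meanDist μ) (hξ0 : 0 < ξ) (hs0 : 0 ≤ s)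
    (hsξ : s < ξ) (hp0 : s / ξ < p) (hkT : ξ - s < 1 - p) {θ : ℝ} (hθ : 1 ≤ θ)
    (hb : 0 ≤ ξ - s - θ * (1 - p - (ξ - s))) (hf : s * (1 + θ) ≤ θ * p) :
    revenueGuarantee ξ s p H * ((1 - p) * (ξ - s - θ * (1 - p - (ξ - s))) -
      (ξ - s - θ * (1 - p - (ξ - s))) ^ 2 / 2 + p * (1 - p) + (1 + θ) * (1 - p - (ξ - s)) ^ 2) ≤
      p * ((1 - p - (ξ - s)) * μ) := by
  have hp : 0 ≤ p := (by positivity : 0 ≤ s / ξ).trans hp0.le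
  have hB := pairBound_revenueGuarantee (ξ := ξ) hH hs0 hp
  have h := hB.combined hθ rfl (by linarith) hkT hb hf (feasible_of_price_gt hξ0 hp0)
  exact h.trans (mul_le_mul_of_nonneg_left
    (mul_le_mul_of_nonneg_left (majorant_id hH (by linarith)) (by linarith)) hp)

theorem guarantee_le_of_lt_two_mul (hH : H ∈ meanDist μ) (hξ0 : 0 < ξ) (hs0 : 0 ≤ s)
    (hsξ : s < ξ) (hp0 : s / ξ < p) (hkT : ξ - s < 1 - p) (hkT2 : 1 - p < 2 * (ξ - s))
    (hps : 2 * s ≤ p) :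
    revenueGuarantee ξ s p H * (1 - p ^ 2) ≤ 2 * p * (1 - p - (ξ - s)) * μ := by
  have := guarantee_mul_le_of_lt_two_mul hH hξ0 hs0 hsξ hp0 hkT le_rfl (by linarith) (by linarith)
  linarith

theorem guarantee_le_of_price_lt_two_mul (hH : H ∈ meanDist μ) (hμ : 0 ≤ μ) (hξ0 : 0 < ξ)
    (hs0 : 0 ≤ s) (hsξ : s < ξ) (hξ1 : ξ < 1) (hp0 : s / ξ < p) (hkT : ξ - s < 1 - p)
    (hps : p < 2 * s) :
    revenueGuarantee ξ s p H ≤ s / ξ * μ := by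
  have hp : 0 < p := (by positivity : 0 ≤ s / ξ).trans_lt hp0
  have hps' : s < p * ξ := by rwa [div_lt_iff₀ hξ0] at hp0
  have hsp : 0 < p - s := by nlinarith
  have hs : 0 < s := by linarith
  set z := 1 - p - (ξ - s) with hz
  have hz0 : 0 < z := by linarith
  -- The smallest ratio for which the pairs are feasible; it exceeds one because `p < 2 * s`.
  set θ := s / (p - s) with hθ
  have hθ1 : 1 ≤ θ := by rw [hθ, le_div_iff₀ hsp]; linarith
  have hθp : θ * (p - s) = s := by rw [hθ]; field_simp
  have hb : 0 ≤ ξ - s - θ * z := by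
    have : θ * z ≤ ξ - s := by
      rw [hθ, div_mul_eq_mul_div, div_le_iff₀ hsp]; nlinarith
    linarith
  have h := guarantee_mul_le_of_lt_two_mul hH hξ0 hs0 hsξ hp0 hkT hθ1 hb (by linarith)
  rw [← hz] at h
  set b := ξ - s - θ * z with hbdef
  set g := revenueGuarantee ξ s p H
  set D := (1 - p) * b - b ^ 2 / 2 + p * (1 - p) + (1 + θ) * z ^ 2 with hD
  -- `D ≥ z p ξ / s`
  have hT : 1 - p = b + (1 + θ) * z := by rw [hbdef, hz]; ring
  have hpξ : p * ξ * θ = s * (p * θ + (ξ - s) * (θ + 1)) := by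
    linear_combination ξ * hθp + (-s) * hθp
  have hDs : z * (p * ξ) ≤ s * D := by
    refine le_of_mul_le_mul_right (a := θ) ?_ (by linarith)
    have e : s * D * θ - z * (p * ξ) * θ =
        s * (θ * b ^ 2 / 2 + z * b * (θ ^ 2 - 1) + p * θ * (b + θ * z)) := by
      have hk : ξ - s = b + θ * z := by rw [hbdef]; ring
      have : z * (p * ξ) * θ = z * (s * (p * θ + (ξ - s) * (θ + 1))) := by rw [← hpξ]; ring
      rw [this, hD, hT, hk]
      ring
    have : 0 ≤ s * (θ * b ^ 2 / 2 + z * b * (θ ^ 2 - 1) + p * θ * (b + θ * z)) := by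
      have : 0 ≤ θ ^ 2 - 1 := by nlinarith
      positivity
    linarith
  have hD0 : 0 < D := pos_of_mul_pos_right ((mul_pos hz0 (mul_pos hp hξ0)).trans_le hDs) hs.le
  refine le_of_mul_le_mul_right (a := D) (h.trans ?_) hD0
  rw [div_mul_eq_mul_div, div_mul_eq_mul_div, le_div_iff₀ hξ0]
  linarith [mul_le_mul_of_nonneg_right hDs hμ]

end UpperBounds

/-! ### The candidate values as functions of price and prior. -/

/-- The price `p*` at low priors, as a function of `k = ξ - s`. -/
noncomputable def lowPrice (k : ℝ) : ℝ := (1 - √(2 * k - k ^ 2)) / (1 - k)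

/-- The revenue at price `x` when the demand is the constant `1 - k / (1 - x)`. -/
noncomputable def flatRevenue (k x : ℝ) : ℝ := x * (1 - x - k) / (1 - x)

/-- The revenue guarantee of uniform information at the price `p*`, with `k = ξ - s`. -/
noncomputable def uniformValue (k μ : ℝ) : ℝ :=
  if μ ≤ (1 + lowPrice k) / 2 then μ * (1 - √(2 * k - k ^ 2))
  else flatRevenue k (min (2 * μ - 1) (1 - √k))

section

variable {k : ℝ}

theorem lowPrice_mul (hk1 : k < 1) : lowPrice k * (1 - k) = 1 - √(2 * k - k ^ 2) := by
  have : 1 - k ≠ 0 := by linarith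
  rw [lowPrice]; field_simp

theorem sqrt_two_mul_sub_lt_one (hk1 : k < 1) : √(2 * k - k ^ 2) < 1 := by
  rw [Real.sqrt_lt' one_pos]; nlinarith [pow_pos (sub_pos.2 hk1) 2]

theorem lowPrice_pos (hk1 : k < 1) : 0 < lowPrice k :=
  div_pos (by linarith [sqrt_two_mul_sub_lt_one hk1]) (by linarith)

/-- The first-order condition for maximizing `p * (1 - p - k) / (1 - p ^ 2)`. -/
theorem lowPrice_eq (hk0 : 0 < k) (hk1 : k < 1) : (1 - k) * (1 + lowPrice k ^ 2) = 2 * lowPrice k := by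
  have h1 := lowPrice_mul hk1
  have h2 : √(2 * k - k ^ 2) ^ 2 = 2 * k - k ^ 2 := Real.sq_sqrt (by nlinarith)
  have h3 : √(2 * k - k ^ 2) = 1 - lowPrice k * (1 - k) := by linarith
  rw [h3] at h2
  refine mul_left_cancel₀ (show (1 - k) ≠ 0 by linarith) ?_
  linear_combination h2

theorem lowPrice_lt (hk0 : 0 < k) (hk1 : k < 1) : lowPrice k < 1 - √k := by
  have h := lowPrice_eq hk0 hk1
  have h1 := lowPrice_mul hk1
  have h2 : k < √(2 * k - k ^ 2) := by rw [Real.lt_sqrt hk0.le]; nlinarith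
  have h3 : lowPrice k < 1 := lt_of_mul_lt_mul_right (by linarith) (by linarith : 0 ≤ 1 - k)
  have h4 : √k < 1 - lowPrice k := by
    rw [Real.sqrt_lt' (by linarith)]
    nlinarith [mul_pos hk0 (pow_pos (lowPrice_pos hk1) 2)]
  linarith

theorem lowPrice_mul_lt (hk0 : 0 < k) (hk1 : k < 1) : 1 - √(2 * k - k ^ 2) < lowPrice k := by
  rw [← lowPrice_mul hk1]
  nlinarith [lowPrice_pos hk1]

theorem one_sub_sqrt_two_mul_lt (hk0 : 0 < k) (hk1 : k < 1) : 1 - √(2 * k) < 1 - √(2 * k - k ^ 2) := by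
  have : √(2 * k - k ^ 2) < √(2 * k) := by
    apply Real.sqrt_lt_sqrt <;> nlinarith
  linarith

theorem flatRevenue_optimal (hk0 : 0 < k) : flatRevenue k (1 - √k) = (1 - √k) ^ 2 := by
  have hs : √k ^ 2 = k := Real.sq_sqrt hk0.le
  have hs0 : 0 < √k := Real.sqrt_pos.2 hk0
  rw [flatRevenue, sub_sub_cancel, div_eq_iff hs0.ne']
  linear_combination (1 - √k) * hs

theorem flatRevenue_le {p : ℝ} (hk0 : 0 < k) (hp : p < 1) :
    flatRevenue k p ≤ (1 - √k) ^ 2 := by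
  have hs : √k ^ 2 = k := Real.sq_sqrt hk0.le
  rw [flatRevenue, div_le_iff₀ (by linarith)]
  nlinarith [sq_nonneg (p - (1 - √k))]

theorem flatRevenue_mono (hk0 : 0 < k) : MonotoneOn (flatRevenue k) (Iic (1 - √k)) := by
  intro p hp x hx hpx
  have hs : √k ^ 2 = k := Real.sq_sqrt hk0.le
  have hs0 : 0 < √k := Real.sqrt_pos.2 hk0
  have hp' : √k ≤ 1 - p := by linarith [show p ≤ 1 - √k from hp]
  have hx' : √k ≤ 1 - x := by linarith [show x ≤ 1 - √k from hx]
  rw [flatRevenue, flatRevenue, div_le_div_iff₀ (by linarith) (by linarith)]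
  have : k ≤ (1 - p) * (1 - x) := by
    rw [← hs, sq]; exact mul_le_mul hp' hx' hs0.le (by linarith)
  nlinarith [mul_nonneg (sub_nonneg.2 hpx) (sub_nonneg.2 this)]

theorem flatRevenue_concaveOn (hk0 : 0 < k) : ConcaveOn ℝ (Iic (1 - √k)) (flatRevenue k) := by
  have hs0 : 0 < √k := Real.sqrt_pos.2 hk0
  refine ⟨convex_Iic _, fun x hx y hy a b ha hb hab => ?_⟩
  have hx' : 0 < 1 - x := by linarith [show x ≤ 1 - √k from hx]
  have hy' : 0 < 1 - y := by linarith [show y ≤ 1 - √k from hy]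
  have e : ∀ z : ℝ, 0 < 1 - z → flatRevenue k z = z + k - k / (1 - z) := fun z hz => by
    rw [flatRevenue]; field_simp; ring
  simp only [smul_eq_mul]
  have hm : 1 - (a * x + b * y) = a * (1 - x) + b * (1 - y) := by
    linear_combination (-1 : ℝ) * hab
  have hpos : 0 < a * (1 - x) + b * (1 - y) := by
    rcases ha.eq_or_lt with rfl | ha
    · have : b = 1 := by linarith
      subst this; linarith
    · have := mul_pos ha hx'
      have := mul_nonneg hb hy'.le
      linarith
  rw [e x hx', e y hy', e _ (hm ▸ hpos), hm]
  have hinv : k / (a * (1 - x) + b * (1 - y)) ≤ a * (k / (1 - x)) + b * (k / (1 - y)) := by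
    rw [mul_div_assoc', mul_div_assoc', div_add_div _ _ hx'.ne' hy'.ne',
      div_le_div_iff₀ hpos (mul_pos hx' hy')]
    have hb' : b = 1 - a := by linarith
    subst hb'
    nlinarith [mul_nonneg (mul_nonneg (mul_nonneg hk0.le ha) hb) (sq_nonneg (x - y))]
  have : a * k + b * k = k := by rw [← add_mul, hab, one_mul]
  linarith

/-- The difference of the two sides is a nonnegative multiple of `(p - lowPrice k) ^ 2`. -/
theorem linear_revenue_le {p : ℝ} (hk0 : 0 < k) (hk1 : k < 1) :
    2 * p * (1 - p - k) ≤ (1 - √(2 * k - k ^ 2)) * (1 - p ^ 2) := by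
  have h := lowPrice_eq hk0 hk1
  have h1 := lowPrice_mul hk1
  have h0 : 0 ≤ √(2 * k - k ^ 2) := Real.sqrt_nonneg _
  have e : lowPrice k * (2 - lowPrice k * (1 - k)) = 1 - k := by linear_combination (-1 : ℝ) * h
  have h2 : 0 ≤ (2 - lowPrice k * (1 - k)) * (p - lowPrice k) ^ 2 :=
    mul_nonneg (by linarith) (sq_nonneg _)
  have h3 : (2 - lowPrice k * (1 - k)) * (p - lowPrice k) ^ 2 =
      p ^ 2 * (2 - lowPrice k * (1 - k)) - 2 * p * (1 - k) + lowPrice k * (1 - k) := by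
    linear_combination (lowPrice k - 2 * p) * e
  rw [← h1]
  linarith

theorem linear_revenue_anti {p x : ℝ} (hk0 : 0 < k) (hk1 : k < 1) (hx : lowPrice k ≤ x)
    (hxp : x ≤ p) (hp : p < 1) :
    p * (1 - p - k) * (1 - x ^ 2) ≤ x * (1 - x - k) * (1 - p ^ 2) := by
  have h := lowPrice_eq hk0 hk1
  have hr := lowPrice_pos hk1
  set r := lowPrice k
  have h2 : (1 - k) * (1 + x * p) ≤ x + p := by
    refine le_of_mul_le_mul_right (a := 1 + r ^ 2) ?_ (by positivity)
    have h3 : 0 ≤ (x - r) * (1 - r * p) + (p - r) * (1 - r * x) := by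
      have : r * p ≤ 1 := by nlinarith
      have : r * x ≤ 1 := by nlinarith
      have := mul_nonneg (sub_nonneg.2 hx) (sub_nonneg.2 ‹r * p ≤ 1›)
      have := mul_nonneg (sub_nonneg.2 (hx.trans hxp)) (sub_nonneg.2 ‹r * x ≤ 1›)
      linarith
    have : (1 - k) * (1 + x * p) * (1 + r ^ 2) = 2 * r * (1 + x * p) := by rw [← h]; ring
    rw [this]
    linarith
  nlinarith [mul_nonneg (sub_nonneg.2 hxp) (sub_nonneg.2 h2)]

theorem flatRevenue_lowPrice (hk0 : 0 < k) (hk1 : k < 1) :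
    flatRevenue k (lowPrice k) = (1 + lowPrice k) / 2 * (1 - √(2 * k - k ^ 2)) := by
  have h := lowPrice_eq hk0 hk1
  have hlt : lowPrice k < 1 := by
    linarith [lowPrice_lt hk0 hk1, Real.sqrt_nonneg k]
  rw [flatRevenue, ← lowPrice_mul hk1, div_eq_iff (by linarith)]
  linear_combination (lowPrice k / 2) * h

theorem uniformValue_of_ge (hk0 : 0 < k) (hk1 : k < 1) {μ : ℝ} (hμ : (1 + lowPrice k) / 2 ≤ μ) :
    uniformValue k μ = flatRevenue k (min (2 * μ - 1) (1 - √k)) := by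
  rcases hμ.eq_or_lt with rfl | h
  · rw [uniformValue, if_pos le_rfl, ← flatRevenue_lowPrice hk0 hk1,
      show 2 * ((1 + lowPrice k) / 2) - 1 = lowPrice k by ring, min_eq_left (lowPrice_lt hk0 hk1).le]
  · rw [uniformValue, if_neg (not_le.2 h)]

theorem uniformValue_one (hk0 : 0 < k) (hk1 : k < 1) : uniformValue k 1 = (1 - √k) ^ 2 := by
  have := lowPrice_lt hk0 hk1
  have := Real.sqrt_nonneg k
  rw [uniformValue_of_ge hk0 hk1 (by linarith), min_eq_right (by linarith),
    flatRevenue_optimal hk0]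

/-- On this range the value is the concave, increasing `flatRevenue` composed with a minimum of
affine functions. -/
theorem uniformValue_concaveOn (hk0 : 0 < k) (hk1 : k < 1) :
    ConcaveOn ℝ (Icc ((1 + lowPrice k) / 2) 1) (uniformValue k) := by
  have hmin : ConcaveOn ℝ (Icc ((1 + lowPrice k) / 2) 1) fun μ : ℝ => min (2 * μ - 1) (1 - √k) := by
    refine ConcaveOn.inf ⟨convex_Icc _ _, fun x _ y _ a b _ _ hab => le_of_eq ?_⟩
      (concaveOn_const _ (convex_Icc _ _))
    simp only [smul_eq_mul]
    linear_combination (-1 : ℝ) * hab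
  have himg : (fun μ : ℝ => min (2 * μ - 1) (1 - √k)) '' Icc ((1 + lowPrice k) / 2) 1 ⊆
      Iic (1 - √k) := by
    rintro _ ⟨μ, -, rfl⟩
    exact mem_Iic.2 (min_le_right _ _)
  have hconv : Convex ℝ ((fun μ : ℝ => min (2 * μ - 1) (1 - √k)) '' Icc ((1 + lowPrice k) / 2) 1) := by
    have : IsPreconnected ((fun μ : ℝ => min (2 * μ - 1) (1 - √k)) ''
        Icc ((1 + lowPrice k) / 2) 1) :=
      isPreconnected_Icc.image _ (Continuous.continuousOn (by fun_prop))
    exact this.ordConnected.convex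
  refine (((flatRevenue_concaveOn hk0).subset himg hconv).comp hmin
    ((flatRevenue_mono hk0).mono himg)).congr fun μ hμ => ?_
  simp [uniformValue_of_ge hk0 hk1 hμ.1]

theorem uniformValue_continuousOn (hk0 : 0 < k) (hk1 : k < 1) :
    ContinuousOn (uniformValue k) (Icc ((1 + lowPrice k) / 2) 1) := by
  have hs0 : 0 < √k := Real.sqrt_pos.2 hk0
  refine ContinuousOn.congr (f := fun μ => flatRevenue k (min (2 * μ - 1) (1 - √k))) ?_
    fun μ hμ => uniformValue_of_ge hk0 hk1 hμ.1
  unfold flatRevenue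
  refine ContinuousOn.div (by fun_prop) (by fun_prop) fun μ _ => ?_
  have := min_le_right (2 * μ - 1) (1 - √k)
  exact ne_of_gt (by linarith)

end

/-- A concave function lies above the minimum of its endpoint values. It is therefore nonnegative
between `a` and a zero `t`, and a positive value beyond `t` would make `f t` positive. -/
theorem exists_crossing {f : ℝ → ℝ} {a b : ℝ} (hab : a ≤ b) (hf : ConcaveOn ℝ (Icc a b) f)
    (hc : ContinuousOn f (Icc a b)) (ha : 0 < f a) (hb : f b ≤ 0) :
    ∃ t ∈ Icc a b, (f b < 0 → t < b) ∧ (∀ x ∈ Icc a t, 0 ≤ f x) ∧ ∀ x ∈ Icc t b, f x ≤ 0 := by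
  obtain ⟨t, ht, hft⟩ := intermediate_value_Icc' hab hc ⟨hb, ha.le⟩
  refine ⟨t, ht, fun h => lt_of_le_of_ne ht.2 ?_, fun x hx => ?_, fun x hx => ?_⟩
  · rintro rfl; exact h.ne hft
  · have := hf.min_le_of_mem_Icc (left_mem_Icc.2 hab) ht hx
    rw [hft, min_eq_right ha.le] at this
    exact this
  · by_contra hcon
    have := hf.min_le_of_mem_Icc (left_mem_Icc.2 hab) ⟨ht.1.trans hx.1, hx.2⟩ ⟨ht.1, hx.1⟩
    rw [hft] at this
    exact absurd this (not_le.2 (lt_min ha (not_le.1 hcon)))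

/-- Combines the bound `flatRevenue`, which ignores `μ`, with the bound linear in `μ`. For high
priors they meet at `p = 2 * μ - 1`: below it the first increases in `p` up to `1 - √k`, above it
the second decreases. -/
theorem guarantee_le_of_price_gt {ξ s μ p : ℝ} {H : Measure ℝ} (hH : H ∈ meanDist μ)
    (hμ : μ ∈ Ioo (0 : ℝ) 1) (hξ0 : 0 < ξ) (hξ1 : ξ < 1) (hs0 : 0 ≤ s) (hsξ : s < ξ)
    (hp0 : s / ξ < p) :
    revenueGuarantee ξ s p H ≤ max (uniformValue (ξ - s) μ) (s / ξ * μ) := by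
  have hr : 0 ≤ s / ξ := by positivity
  have hp : 0 < p := hr.trans_lt hp0
  have hpξ : s < p * ξ := by rwa [div_lt_iff₀ hξ0] at hp0
  have hk0 : 0 < ξ - s := by linarith
  have hk1 : ξ - s < 1 := by linarith
  rcases le_or_gt (1 - p) (ξ - s) with hkT | hkT
  · exact ((guarantee_nonpos hH hξ1 hs0 hsξ hp.le hkT).trans (mul_nonneg hr hμ.1.le)).trans
      (le_max_right _ _)
  have hconst : revenueGuarantee ξ s p H ≤ flatRevenue (ξ - s) p :=
    guarantee_le_constant hH hξ0 hs0 hsξ hp0 hkT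
  have hlin : revenueGuarantee ξ s p H * (1 - p ^ 2) ≤ 2 * p * (1 - p - (ξ - s)) * μ ∨
      revenueGuarantee ξ s p H ≤ s / ξ * μ ∨
      (p ≤ 1 - √(2 * (ξ - s)) ∧ revenueGuarantee ξ s p H ≤ (1 - √(2 * (ξ - s))) * μ) := by
    rcases le_or_gt (2 * (ξ - s)) (1 - p) with h2 | h2
    · rcases le_or_gt ((1 - p) ^ 2) (2 * (ξ - s)) with h3 | h3
      · exact Or.inl (guarantee_le_of_two_mul_le hH hξ0 hs0 hsξ hp0 h2 h3)
      · refine Or.inr (Or.inr ?_)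
        have hA0 : 0 < √(2 * (ξ - s)) := Real.sqrt_pos.2 (by linarith)
        have hAT : √(2 * (ξ - s)) ≤ 1 - p := by
          rw [Real.sqrt_le_left (by linarith)]; exact h3.le
        exact ⟨by linarith, guarantee_le_of_price_le_of_sq_eq hH hs0 hsξ hp.le hA0 (by linarith)
          (Real.sq_sqrt (by linarith)) (by nlinarith) (by linarith)⟩
    · rcases le_or_gt (2 * s) p with h3 | h3
      · exact Or.inl (guarantee_le_of_lt_two_mul hH hξ0 hs0 hsξ hp0 hkT h2 h3)
      · exact Or.inr (Or.inl (guarantee_le_of_price_lt_two_mul hH hμ.1.le hξ0 hs0 hsξ hξ1 hp0 hkT h3))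
  set k := ξ - s
  set g := revenueGuarantee ξ s p H
  have hp1 : p < 1 := by linarith
  have hp2 : 0 < 1 - p ^ 2 := by nlinarith
  have hp1lt := one_sub_sqrt_two_mul_lt hk0 hk1
  rcases le_or_gt μ ((1 + lowPrice k) / 2) with hm | hm
  · rw [uniformValue, if_pos hm]
    rcases hlin with h | h | ⟨-, h⟩
    · refine le_max_of_le_left (le_of_mul_le_mul_right (h.trans ?_) hp2)
      have := mul_le_mul_of_nonneg_right (linear_revenue_le (p := p) hk0 hk1) hμ.1.le
      linarith
    · exact le_max_of_le_right h
    · refine le_max_of_le_left (h.trans ?_)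
      rw [mul_comm]
      exact mul_le_mul_of_nonneg_left hp1lt.le hμ.1.le
  · rw [uniformValue_of_ge hk0 hk1 hm.le]
    have hrc := lowPrice_lt hk0 hk1
    rcases le_or_gt p (min (2 * μ - 1) (1 - √k)) with hpx | hpx
    · exact le_max_of_le_left (hconst.trans
        (flatRevenue_mono hk0 (mem_Iic.2 (hpx.trans (min_le_right _ _)))
          (mem_Iic.2 (min_le_right _ _)) hpx))
    rcases le_or_gt (1 - √k) (2 * μ - 1) with hx | hx
    · rw [min_eq_right hx, flatRevenue_optimal hk0]
      exact le_max_of_le_left (hconst.trans (flatRevenue_le hk0 hp1))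
    rw [min_eq_left hx.le] at hpx ⊢
    rcases hlin with h | h | ⟨h, -⟩
    · refine le_max_of_le_left ?_
      have h4 := linear_revenue_anti hk0 hk1 (by linarith) hpx.le hp1
      have h5 : g * (1 - p ^ 2) * (1 - (2 * μ - 1)) ≤
          (2 * μ - 1) * (1 - (2 * μ - 1) - k) * (1 - p ^ 2) := by
        have h6 := mul_le_mul_of_nonneg_right h (by linarith [hμ.2] : 0 ≤ 1 - (2 * μ - 1))
        refine h6.trans (le_trans (le_of_eq ?_) h4)
        ring
      rw [flatRevenue, le_div_iff₀ (by linarith [hμ.2])]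
      refine le_of_mul_le_mul_right ?_ hp2
      linarith
    · exact le_max_of_le_right h
    -- Impossible: `p ≤ 1 - √(2k) < lowPrice k < 2 * μ - 1 < p`.
    · linarith [lowPrice_mul_lt hk0 hk1]

/-! ### Guarantees of the three information policies. -/

/-- Atoms of mass `m₀` at `0` and `m₁` at `1` together with constant density `c` on `[x, 1]`. -/
noncomputable def atomsWithDensity (m₀ c x m₁ : ℝ) : Measure ℝ :=
  ENNReal.ofReal m₀ • Measure.dirac 0 +
    (ENNReal.ofReal c • volume.restrict (Icc x 1) + ENNReal.ofReal m₁ • Measure.dirac 1)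

section

variable {m₀ c x m₁ : ℝ}

instance : IsFiniteMeasure (atomsWithDensity m₀ c x m₁) := by
  unfold atomsWithDensity
  have h : ∀ (r : ℝ) (ν : Measure ℝ) [IsFiniteMeasure ν], IsFiniteMeasure (ENNReal.ofReal r • ν) :=
    fun r ν _ => Measure.smul_finite ν ENNReal.ofReal_ne_top
  have := h m₀ (Measure.dirac 0)
  have := h c (volume.restrict (Icc x 1))
  have := h m₁ (Measure.dirac 1)
  infer_instance

theorem atomsWithDensity_real (h₀ : 0 ≤ m₀) (hc : 0 ≤ c) (h₁ : 0 ≤ m₁) {S : Set ℝ}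
    (hS : MeasurableSet S) :
    (atomsWithDensity m₀ c x m₁).real S =
      m₀ * S.indicator 1 0 + (c * volume.real (S ∩ Icc x 1) + m₁ * S.indicator 1 1) := by
  have hd : ∀ y : ℝ, (Measure.dirac y S).toReal = S.indicator 1 y := fun y => by
    rw [Measure.dirac_apply' _ hS]
    by_cases hy : y ∈ S <;> simp [hy]
  have hfin : volume (S ∩ Icc x 1) ≠ ⊤ :=
    ((measure_mono inter_subset_right).trans_lt (by simp : volume (Icc x 1) < ⊤)).ne
  rw [measureReal_def, atomsWithDensity, Measure.add_apply, Measure.add_apply, Measure.smul_apply,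
    Measure.smul_apply, Measure.smul_apply, Measure.restrict_apply hS, smul_eq_mul, smul_eq_mul,
    smul_eq_mul, ENNReal.toReal_add (by finiteness) (by finiteness),
    ENNReal.toReal_add (by finiteness) (by finiteness), ENNReal.toReal_mul, ENNReal.toReal_mul,
    ENNReal.toReal_mul, ENNReal.toReal_ofReal h₀, ENNReal.toReal_ofReal hc,
    ENNReal.toReal_ofReal h₁, hd, hd, measureReal_def]

theorem atomsWithDensity_mem_meanDist {μ : ℝ} (h₀ : 0 ≤ m₀) (hc : 0 ≤ c) (h₁ : 0 ≤ m₁)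
    (hx0 : 0 ≤ x) (hx1 : x ≤ 1) (hmass : m₀ + c * (1 - x) + m₁ = 1)
    (hmean : c * (1 - x ^ 2) / 2 + m₁ = μ) : atomsWithDensity m₀ c x m₁ ∈ meanDist μ := by
  refine ⟨⟨?_⟩, ?_, ?_⟩
  · rw [← ENNReal.toReal_eq_one_iff, ← measureReal_def,
      atomsWithDensity_real h₀ hc h₁ MeasurableSet.univ]
    simp only [univ_inter, Real.volume_real_Icc_of_le hx1, indicator_univ, Pi.one_apply]
    linarith
  · have e : (Icc (0 : ℝ) 1)ᶜ ∩ Icc x 1 = ∅ := by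
      ext w
      simp only [mem_inter_iff, mem_compl_iff, mem_Icc, mem_empty_iff_false, iff_false]
      rintro ⟨h, h1, h2⟩
      exact h ⟨hx0.trans h1, h2⟩
    refine (measureReal_eq_zero_iff).1 ?_
    rw [atomsWithDensity_real h₀ hc h₁ measurableSet_Icc.compl, e]
    simp
  · have hi : ∀ d : ℝ, Integrable (fun v : ℝ => v) (Measure.dirac d) := fun d =>
      integrable_dirac (by simp)
    have hv : Integrable (fun v : ℝ => v) (volume.restrict (Icc x 1)) :=
      (continuous_id.integrableOn_Icc)
    rw [atomsWithDensity, integral_add_measure ((hi 0).smul_measure (by simp))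
      (((hv.smul_measure (by simp))).add_measure ((hi 1).smul_measure (by simp))),
      integral_add_measure (hv.smul_measure (by simp)) ((hi 1).smul_measure (by simp)),
      integral_smul_measure, integral_smul_measure, integral_smul_measure, integral_dirac,
      integral_dirac, integral_Icc_eq_integral_Ioc, ← intervalIntegral.integral_of_le hx1,
      integral_id, ENNReal.toReal_ofReal hc, ENNReal.toReal_ofReal h₁]
    simp only [smul_eq_mul]
    linarith

/-- Every posterior above `p + min v a` buys, and the atom at `1` buys without search once `a ≤ 1 -
p`. -/
theorem le_atomsWithDensity_real (h₀ : 0 ≤ m₀) (hc : 0 ≤ c) (h₁ : 0 ≤ m₁) (p a v : ℝ) :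
    c * (1 - max (p + min v a) x) + (if a ≤ 1 - p then m₁ else 0) ≤
      (atomsWithDensity m₀ c x m₁).real {w | a ≤ w - p ∨ v < w - p} := by
  have hS : MeasurableSet {w : ℝ | a ≤ w - p ∨ v < w - p} :=
    (measurableSet_le measurable_const (measurable_id.sub_const p)).union
      (measurableSet_lt measurable_const (measurable_id.sub_const p))
  rw [atomsWithDensity_real h₀ hc h₁ hS]
  set S := {w : ℝ | a ≤ w - p ∨ v < w - p} with hSdef
  have hnn : ∀ y : ℝ, 0 ≤ S.indicator (1 : ℝ → ℝ) y := fun y =>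
    indicator_nonneg (fun _ _ => zero_le_one) y
  have hvol : 1 - max (p + min v a) x ≤ volume.real (S ∩ Icc x 1) := by
    have hsub : Ioc (max (p + min v a) x) 1 ⊆ S ∩ Icc x 1 := by
      intro w hw
      have h1 := (max_lt_iff.1 hw.1)
      refine ⟨?_, h1.2.le, hw.2⟩
      rcases min_lt_iff.1 (show min v a < w - p by linarith [h1.1]) with h | h
      · exact Or.inr h
      · exact Or.inl h.le
    have hfin : volume (S ∩ Icc x 1) ≠ ⊤ :=
      ((measure_mono inter_subset_right).trans_lt (by simp : volume (Icc x 1) < ⊤)).ne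
    refine le_trans ?_ (measureReal_mono hsub hfin)
    rw [Real.volume_real_Ioc]
    exact le_max_left _ _
  have h1 : (if a ≤ 1 - p then m₁ else 0) ≤ m₁ * S.indicator (1 : ℝ → ℝ) 1 := by
    split_ifs with h
    · rw [indicator_of_mem (show (1 : ℝ) ∈ S from Or.inl h)]; simp
    · exact mul_nonneg h₁ (hnn 1)
  nlinarith [mul_le_mul_of_nonneg_left hvol hc, mul_nonneg h₀ (hnn 0)]

theorem atomsWithDensity_real_Iio_one (h₀ : 0 ≤ m₀) (hc : 0 ≤ c) (h₁ : 0 ≤ m₁) (hx1 : x ≤ 1) :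
    (atomsWithDensity m₀ c x m₁).real (Iio 1) = m₀ + c * (1 - x) := by
  have e : Iio 1 ∩ Icc x 1 = Ico x 1 := by
    ext w
    simp only [mem_inter_iff, mem_Iio, mem_Icc, mem_Ico]
    exact ⟨fun h => ⟨h.2.1, h.1⟩, fun h => ⟨h.2, h.1, h.2.le⟩⟩
  rw [atomsWithDensity_real h₀ hc h₁ measurableSet_Iio, e, Real.volume_real_Ico_of_le hx1]
  simp

theorem le_atomsWithDensity_real_Iic (h₀ : 0 ≤ m₀) (hc : 0 ≤ c) (h₁ : 0 ≤ m₁) {p : ℝ}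
    (hp : 0 ≤ p) : m₀ ≤ (atomsWithDensity m₀ c x m₁).real (Iic p) := by
  rw [atomsWithDensity_real h₀ hc h₁ measurableSet_Iic,
    indicator_of_mem (show (0 : ℝ) ∈ Iic p from hp)]
  have : 0 ≤ (Iic p).indicator (1 : ℝ → ℝ) 1 := indicator_nonneg (fun _ _ => zero_le_one) 1
  have : 0 ≤ volume.real (Iic p ∩ Icc x 1) := measureReal_nonneg
  simp only [Pi.one_apply]
  nlinarith [mul_nonneg hc this, mul_nonneg h₁ ‹0 ≤ (Iic p).indicator (1 : ℝ → ℝ) 1›]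

/-- Nature's reply has effective options `0` and `1 - p`: the upper one deters every posterior below
`1`, the lower one only those at most `p`. -/
theorem exists_revenue_atomsWithDensity_le {ξ s μ p : ℝ} (h₀ : 0 ≤ m₀) (hc : 0 ≤ c) (h₁ : 0 ≤ m₁)
    (hx1 : x ≤ 1) (hH : atomsWithDensity m₀ c x m₁ ∈ meanDist μ) (hs0 : 0 ≤ s) (hsξ : s < ξ)
    (hp : 0 ≤ p) (hkT : ξ - s < 1 - p) (hf : s * (1 - p) ≤ (ξ - s) * p) :
    ∃ G ∈ meanDist ξ, revenue s p (atomsWithDensity m₀ c x m₁) G ≤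
      p * (1 - m₀ - (ξ - s) / (1 - p) * (c * (1 - x))) := by
  have := hH.1
  have hT : 0 < 1 - p := by linarith
  obtain ⟨G, hG, hle⟩ := exists_outside_option (ξ := ξ) (s := s) (p := p) (b := 0) (a := 1 - p)
    (atomsWithDensity m₀ c x m₁) hs0 hp le_rfl (by linarith) hkT (by linarith)
  refine ⟨G, hG, le_of_mul_le_mul_right ?_ hT⟩
  rw [sub_zero, sub_zero, add_zero, add_sub_cancel,
    atomsWithDensity_real_Iio_one h₀ hc h₁ hx1] at hle
  refine hle.trans ?_
  rw [mul_assoc]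
  refine mul_le_mul_of_nonneg_left ?_ hp
  have e : (1 - m₀ - (ξ - s) / (1 - p) * (c * (1 - x))) * (1 - p) =
      (1 - p) - (ξ - s) * (m₀ + c * (1 - x)) - (1 - p - (ξ - s)) * m₀ := by
    field_simp; ring
  rw [e]
  have := mul_le_mul_of_nonneg_left (le_atomsWithDensity_real_Iic (x := x) h₀ hc h₁ hp)
    (by linarith : 0 ≤ 1 - p - (ξ - s))
  linarith

end

theorem fullInfo_eq (μ x : ℝ) : fullInfo μ = atomsWithDensity (1 - μ) 0 x μ := by
  simp [fullInfo, atomsWithDensity]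

theorem mixtureInfo_eq (ξ s μ : ℝ) : mixtureInfo ξ s μ =
    atomsWithDensity 0 (2 * ξ ^ 2 * (1 - μ) / (ξ - s) ^ 2) (s / ξ)
      (1 - 2 * ξ * (1 - μ) / (ξ - s)) := by
  simp [mixtureInfo, atomsWithDensity]

theorem fullOptimal_of_bound {ξ s μ : ℝ} (hμ : μ ∈ Ioo (0 : ℝ) 1) (hξ0 : 0 < ξ) (hξ1 : ξ < 1)
    (hs0 : 0 ≤ s) (hsξ : s < ξ)
    (hup : ∀ p' ∈ Icc (0 : ℝ) 1, ∀ H' ∈ meanDist μ, revenueGuarantee ξ s p' H' ≤ s / ξ * μ) :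
    FullOptimal ξ s μ := by
  have hr0 : 0 ≤ s / ξ := by positivity
  have hr1 : s / ξ < 1 := by rw [div_lt_one hξ0]; exact hsξ
  have hs : s = s / ξ * ξ := by field_simp
  have h₀ : 0 ≤ 1 - μ := by linarith [hμ.2]
  have hH : atomsWithDensity (1 - μ) 0 1 μ ∈ meanDist μ :=
    atomsWithDensity_mem_meanDist h₀ le_rfl hμ.1.le zero_le_one le_rfl (by ring) (by ring)
  have := hH.1
  rw [FullOptimal, fullInfo_eq μ 1]
  refine isRobustlyOptimal_of_value (s / ξ * μ) ⟨hr0, hr1.le⟩ hH (fun G hG => ?_) ?_ hup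
  -- Constant minorant: since `a ≤ 1 - s/ξ = 1 - p`, the posterior `1` always buys.
  · have := le_revenue (H := atomsWithDensity (1 - μ) 0 1 μ) (c := μ) (d := 0) hG hξ0 hs0 hsξ hr0
      fun a ha v hv => by
        have := le_atomsWithDensity_real (x := 1) h₀ le_rfl hμ.1.le (s / ξ) a v
        rw [if_pos ha.2] at this
        linarith
    rwa [zero_mul, sub_zero] at this
  · obtain ⟨G, hG, hle⟩ := exists_revenue_atomsWithDensity_le h₀ le_rfl hμ.1.le le_rfl hH hs0 hsξ hr0
      (by nlinarith) (by nlinarith)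
    exact ⟨G, hG, by linarith⟩

theorem mixtureOptimal_of_bound {ξ s μ : ℝ} (hμ : μ ∈ Ioo (0 : ℝ) 1) (hξ0 : 0 < ξ) (hξ1 : ξ < 1)
    (hs0 : 0 ≤ s) (hsξ : s < ξ) (hμs : (1 + s / ξ) / 2 ≤ μ)
    (hup : ∀ p' ∈ Icc (0 : ℝ) 1, ∀ H' ∈ meanDist μ,
      revenueGuarantee ξ s p' H' ≤ s / ξ * (1 - 2 * ξ ^ 2 / (ξ - s) * (1 - μ))) :
    MixtureOptimal ξ s μ := by
  have hr0 : 0 ≤ s / ξ := by positivity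
  have hr1 : s / ξ < 1 := by rw [div_lt_one hξ0]; exact hsξ
  have hs : s = s / ξ * ξ := by field_simp
  have hk : 0 < ξ - s := by linarith
  rw [MixtureOptimal, mixtureInfo_eq]
  set r := s / ξ with hr
  have hkr : ξ - s = ξ * (1 - r) := by linear_combination (-1 : ℝ) * hs
  have hq : 0 < 1 - r := by linarith
  have h1μ : 0 < 1 - μ := by linarith [hμ.2]
  have ec : 2 * ξ ^ 2 * (1 - μ) / (ξ - s) ^ 2 = 2 * (1 - μ) / (1 - r) ^ 2 := by
    rw [hkr]; field_simp
  have em : 1 - 2 * ξ * (1 - μ) / (ξ - s) = 1 - 2 * (1 - μ) / (1 - r) := by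
    rw [hkr]; field_simp
  have eV : 2 * ξ ^ 2 / (ξ - s) * (1 - μ) = 2 * (1 - μ) / (1 - r) ^ 2 * (ξ - s) := by
    rw [hkr]; field_simp
  rw [ec, em]
  rw [eV] at hup
  set c := 2 * (1 - μ) / (1 - r) ^ 2 with hc
  set m := 1 - 2 * (1 - μ) / (1 - r) with hm
  have hc0 : 0 ≤ c := by positivity
  -- The atom has nonnegative mass exactly when `μ ≥ (1 + s/ξ)/2`.
  have hm0 : 0 ≤ m := by
    rw [hm, sub_nonneg, div_le_one hq]; linarith
  have hmass : c * (1 - r) + m = 1 := by rw [hc, hm]; field_simp; ring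
  have hH : atomsWithDensity 0 c r m ∈ meanDist μ :=
    atomsWithDensity_mem_meanDist le_rfl hc0 hm0 hr0 hr1.le (by linarith)
      (by rw [hc, hm]; field_simp; ring)
  have := hH.1
  refine isRobustlyOptimal_of_value (r * (1 - c * (ξ - s))) ⟨hr0, hr1.le⟩ hH (fun G hG => ?_) ?_ hup
  · refine le_revenue hG hξ0 hs0 hsξ hr0 fun a ha v hv => ?_
    have h := le_atomsWithDensity_real (x := r) le_rfl hc0 hm0 r a v
    rw [if_pos ha.2, max_eq_left (by linarith [le_min hv.1 ha.1.le])] at h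
    refine le_trans (le_of_eq ?_) h
    linear_combination (-1 : ℝ) * hmass
  · obtain ⟨G, hG, hle⟩ := exists_revenue_atomsWithDensity_le le_rfl hc0 hm0 hr1.le hH hs0 hsξ hr0
      (by nlinarith) (by nlinarith)
    refine ⟨G, hG, hle.trans (le_of_eq ?_)⟩
    field_simp
    ring

theorem muLow_eq (ξ s : ℝ) (h : 1 - (ξ - s) ≠ 0) : muLow ξ s = (1 + lowPrice (ξ - s)) / 2 := by
  have h' : 1 - ξ + s ≠ 0 := by rwa [← sub_add] at h
  rw [muLow, lowPrice]
  field_simp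
  ring

theorem pStar_eq (ξ s μ : ℝ) (h : 1 - (ξ - s) ≠ 0) : pStar ξ s μ =
    if μ ≤ (1 + lowPrice (ξ - s)) / 2 then lowPrice (ξ - s)
    else if μ ≤ 1 - √(ξ - s) / 2 then 2 * μ - 1 else 1 - √(ξ - s) := by
  rw [pStar, muLow_eq ξ s h, muHigh, lowPrice, sub_add]

theorem lowPrice_le_pStar {ξ s : ℝ} (hk0 : 0 < ξ - s) (hk1 : ξ - s < 1) (μ : ℝ) :
    lowPrice (ξ - s) ≤ pStar ξ s μ := by
  rw [pStar_eq ξ s μ (by linarith)]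
  have := lowPrice_lt hk0 hk1
  split_ifs <;> linarith

theorem uniformInfo_eq_of_lt {ξ s μ : ℝ} (h : 1 - √(ξ - s) / 2 < μ) :
    uniformInfo ξ s μ = atomsWithDensity 0 (1 / (2 - 2 * μ)) (2 * μ - 1) 0 := by
  rw [uniformInfo, if_pos h]
  simp [atomsWithDensity]

theorem uniformInfo_eq_of_le {ξ s μ : ℝ} (h : μ ≤ 1 - √(ξ - s) / 2) :
    uniformInfo ξ s μ = atomsWithDensity (1 - 2 * μ / (1 + pStar ξ s μ))
      (2 * μ / (1 - pStar ξ s μ ^ 2)) (pStar ξ s μ) 0 := by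
  rw [uniformInfo, if_neg (not_lt.2 h)]
  simp [atomsWithDensity]

/-- The common form `c * p * (1 - p - k)`, with `c` the density, is the revenue from the affine
demand `c * (1 - p - u)` at mean effective option `k`. The inequality on `2 * μ` makes the atom at
`0` nonnegative. -/
theorem uniformValue_of_pStar {ξ s μ : ℝ} (hk0 : 0 < ξ - s) (hk1 : ξ - s < 1)
    (hμ1 : μ < 1) (h : μ ≤ 1 - √(ξ - s) / 2) :
    uniformValue (ξ - s) μ = 2 * μ / (1 - pStar ξ s μ ^ 2) *
      (pStar ξ s μ * (1 - pStar ξ s μ - (ξ - s))) ∧ 2 * μ ≤ 1 + pStar ξ s μ ∧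
      pStar ξ s μ + (ξ - s) < 1 := by
  have hlow := lowPrice_lt hk0 hk1
  have hpos := lowPrice_pos hk1
  have hsq : √(ξ - s) ^ 2 = ξ - s := Real.sq_sqrt hk0.le
  have hs0 : 0 < √(ξ - s) := Real.sqrt_pos.2 hk0
  have hs1 : √(ξ - s) < 1 := by linarith
  have hss : ξ - s < √(ξ - s) := by nlinarith
  rw [pStar_eq ξ s μ (by linarith)]
  by_cases hm : μ ≤ (1 + lowPrice (ξ - s)) / 2
  · rw [if_pos hm, uniformValue, if_pos hm]
    refine ⟨?_, by linarith, by linarith⟩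
    have h1 := lowPrice_mul hk1
    have h2 := lowPrice_eq hk0 hk1
    have h3 : 1 - lowPrice (ξ - s) ^ 2 ≠ 0 := by nlinarith
    rw [← h1, div_mul_eq_mul_div, eq_div_iff h3]
    linear_combination (-(μ * lowPrice (ξ - s))) * h2
  · rw [if_neg hm, if_pos h, uniformValue, if_neg hm, min_eq_left (by linarith), flatRevenue]
    refine ⟨?_, by linarith, by linarith⟩
    have h3 : 1 - (2 * μ - 1) ≠ 0 := by linarith
    have h4 : μ ≠ 0 := by linarith
    have h5 : 1 - (2 * μ - 1) ^ 2 = 2 * μ * (1 - (2 * μ - 1)) := by ring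
    rw [h5]
    field_simp

theorem uniformOptimal_of_bound {ξ s μ : ℝ} (hμ : μ ∈ Ioo (0 : ℝ) 1) (hξ0 : 0 < ξ) (hξ1 : ξ < 1)
    (hs0 : 0 ≤ s) (hsξ : s < ξ) (hlow : s / ξ < lowPrice (ξ - s))
    (hup : ∀ p' ∈ Icc (0 : ℝ) 1, ∀ H' ∈ meanDist μ,
      revenueGuarantee ξ s p' H' ≤ uniformValue (ξ - s) μ) :
    UniformOptimal ξ s μ := by
  have hk0 : 0 < ξ - s := by linarith
  have hk1 : ξ - s < 1 := by linarith
  have hgt : s / ξ < pStar ξ s μ := hlow.trans_le (lowPrice_le_pStar hk0 hk1 μ)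
  refine ⟨hgt, ?_⟩
  have hf := (feasible_of_price_gt hξ0 hgt).le
  have hp0 : 0 < pStar ξ s μ := (by positivity : 0 ≤ s / ξ).trans_lt hgt
  rcases le_or_gt μ (1 - √(ξ - s) / 2) with h | h
  · obtain ⟨hV, h2μ, hpk⟩ := uniformValue_of_pStar hk0 hk1 hμ.2 h
    rw [uniformInfo_eq_of_le h]
    rw [hV] at hup
    set p := pStar ξ s μ
    set k := ξ - s with hk
    have hp1 : p < 1 := by linarith
    have hq : 0 < 1 - p := by linarith
    have hq2 : 0 < 1 - p ^ 2 := by nlinarith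
    have hq3 : 0 < 1 + p := by linarith
    have hμ0 := hμ.1
    have e2 : 1 - p ^ 2 = (1 + p) * (1 - p) := by ring
    set c := 2 * μ / (1 - p ^ 2) with hc
    set m := 1 - 2 * μ / (1 + p) with hm
    have hc0 : 0 ≤ c := by positivity
    have hm0 : 0 ≤ m := by rw [hm, sub_nonneg, div_le_one hq3]; exact h2μ
    have hmass : m + c * (1 - p) = 1 := by rw [hc, hm, e2]; field_simp; ring
    have hH : atomsWithDensity m c p 0 ∈ meanDist μ :=
      atomsWithDensity_mem_meanDist hm0 hc0 le_rfl hp0.le hp1.le (by linarith)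
        (by rw [hc]; field_simp; ring)
    have := hH.1
    refine isRobustlyOptimal_of_value _ ⟨hp0.le, hp1.le⟩ hH (fun G hG => ?_) ?_ hup
    · have := le_revenue (H := atomsWithDensity m c p 0) (c := c * (1 - p)) (d := c) hG hξ0 hs0 hsξ
        hp0.le fun a ha v hv => by
          have h := le_atomsWithDensity_real (x := p) hm0 hc0 le_rfl p a v
          rw [ite_self, max_eq_left (by linarith [le_min hv.1 ha.1.le])] at h
          linarith
      refine le_trans (le_of_eq ?_) this
      ring
    · obtain ⟨G, hG, hle⟩ := exists_revenue_atomsWithDensity_le hm0 hc0 le_rfl hp1.le hH hs0 hsξ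
        hp0.le (by linarith) hf
      refine ⟨G, hG, hle.trans (le_of_eq ?_)⟩
      rw [show 1 - m = c * (1 - p) by linarith, ← hk]
      field_simp
  · have hs : √(ξ - s) ^ 2 = ξ - s := Real.sq_sqrt hk0.le
    have hs0' : 0 < √(ξ - s) := Real.sqrt_pos.2 hk0
    have hlt := lowPrice_lt hk0 hk1
    have hp : pStar ξ s μ = 1 - √(ξ - s) := by
      rw [pStar_eq ξ s μ (by linarith), if_neg (by linarith), if_neg (by linarith)]
    rw [uniformInfo_eq_of_lt h]
    rw [uniformValue_of_ge hk0 hk1 (by linarith), min_eq_right (by linarith),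
      flatRevenue_optimal hk0, ← hp] at hup
    have hT : √(ξ - s) = 1 - pStar ξ s μ := by linarith
    have hkp : ξ - s = (1 - pStar ξ s μ) ^ 2 := by rw [← hs, hT]
    set p := pStar ξ s μ
    have hq : 0 < 2 - 2 * μ := by linarith [hμ.2]
    have hT0 : 0 < 1 - p := by linarith
    have hc0 : 0 ≤ 1 / (2 - 2 * μ) := by positivity
    have hx : 1 - (2 * μ - 1) = 2 - 2 * μ := by ring
    have hcx : 1 / (2 - 2 * μ) * (2 - 2 * μ) = 1 := one_div_mul_cancel hq.ne'
    have hH : atomsWithDensity 0 (1 / (2 - 2 * μ)) (2 * μ - 1) 0 ∈ meanDist μ :=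
      atomsWithDensity_mem_meanDist le_rfl hc0 le_rfl (by linarith) (by linarith)
        (by rw [hx]; linarith) (by linear_combination μ * hcx)
    have := hH.1
    refine isRobustlyOptimal_of_value _ ⟨hp0.le, by linarith⟩ hH (fun G hG => ?_) ?_ hup
    -- Demand is the truncation to `[0,1]` of a line of slope `-1/(2 - 2μ)` vanishing at `1 - p`. As
    -- `2 - 2μ < 1 - p`, it lies above the line joining `1` at `u = 0` to `0` at `u = 1 - p`.
    · have := le_revenue (H := atomsWithDensity 0 (1 / (2 - 2 * μ)) (2 * μ - 1) 0)
        (c := 1) (d := 1 / (1 - p)) hG hξ0 hs0 hsξ hp0.le fun a ha v hv => by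
          have h1 := le_atomsWithDensity_real (x := 2 * μ - 1) le_rfl hc0 le_rfl p a v
          rw [ite_self, add_zero] at h1
          have hu := le_min hv.1 ha.1.le
          set u := min v a
          rcases le_or_gt u (1 - p) with h2 | h2
          · refine le_trans ?_ h1
            rcases le_total (p + u) (2 * μ - 1) with h3 | h3
            · rw [max_eq_right h3, hx, hcx]
              have : 0 ≤ 1 / (1 - p) * u := by positivity
              linarith
            · rw [max_eq_left h3, show 1 - 1 / (1 - p) * u = (1 - p - u) / (1 - p) by field_simp,
                show 1 / (2 - 2 * μ) * (1 - (p + u)) = (1 - p - u) / (2 - 2 * μ) by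
                  rw [div_mul_eq_mul_div, one_mul]; ring]
              exact div_le_div_of_nonneg_left (by linarith) hq (by linarith)
          · refine le_trans ?_ measureReal_nonneg
            rw [div_mul_eq_mul_div, one_mul, sub_nonpos, one_le_div hT0]
            exact h2.le
      refine le_trans (le_of_eq ?_) this
      rw [hkp]; field_simp; ring
    · obtain ⟨G, hG, hle⟩ := exists_revenue_atomsWithDensity_le le_rfl hc0 le_rfl (by linarith) hH
        hs0 hsξ hp0.le (by nlinarith) hf
      refine ⟨G, hG, hle.trans (le_of_eq ?_)⟩
      rw [hkp, hx, hcx]; field_simp; ring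

/-! ### Comparing the two candidates and locating the regimes. -/

/-- The best guarantee at the price `s / ξ` when the prior is high. -/
noncomputable def thresholdValue (ξ s μ : ℝ) : ℝ :=
  s / ξ * (1 - min 1 (2 * ξ ^ 2 / (ξ - s)) * (1 - μ))

theorem thresholdValue_of_le {ξ s : ℝ} (hsξ : s < ξ) (h : ξ - s ≤ 2 * ξ ^ 2) (μ : ℝ) :
    thresholdValue ξ s μ = s / ξ * μ := by
  rw [thresholdValue, min_eq_left (by rw [one_le_div (by linarith)]; exact h)]
  ring

theorem thresholdValue_of_ge {ξ s : ℝ} (hsξ : s < ξ) (h : 2 * ξ ^ 2 ≤ ξ - s) (μ : ℝ) :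
    thresholdValue ξ s μ = s / ξ * (1 - 2 * ξ ^ 2 / (ξ - s) * (1 - μ)) := by
  rw [thresholdValue, min_eq_right (by rw [div_le_one (by linarith)]; exact h)]

theorem le_thresholdValue {ξ s μ : ℝ} (hξ0 : 0 < ξ) (hs0 : 0 ≤ s) (hμ : μ ≤ 1) :
    s / ξ * μ ≤ thresholdValue ξ s μ := by
  refine mul_le_mul_of_nonneg_left ?_ (by positivity)
  nlinarith [mul_le_mul_of_nonneg_right (min_le_left (1 : ℝ) (2 * ξ ^ 2 / (ξ - s)))
    (sub_nonneg.2 hμ)]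

/-- Rationalizing the square root shows that `B1` marks where `s/ξ` equals the slope of
`uniformValue` at low priors. -/
theorem sub_B1_eq {ξ s : ℝ} (hξ0 : 0 < ξ) (hsξ : s < ξ) (hk1 : ξ - s < 1) :
    ∃ c > 0, s - B1 ξ = c * (s / ξ - (1 - √(2 * (ξ - s) - (ξ - s) ^ 2))) := by
  set k := ξ - s with hk
  have hk0 : 0 < k := by linarith
  have hy : √(2 * k - k ^ 2) ^ 2 = 2 * k - k ^ 2 := Real.sq_sqrt (by nlinarith)
  set y := √(2 * k - k ^ 2)
  have hy0 : 0 ≤ y := Real.sqrt_nonneg _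
  have hs : s = ξ - k := by linarith
  refine ⟨ξ ^ 2 * (y + k / ξ) / (k * (1 + ξ ^ 2)), by positivity, ?_⟩
  rw [hs, B1]
  have : ξ ^ 2 + 1 ≠ 0 := by positivity
  field_simp
  linear_combination (-(ξ ^ 4 + ξ ^ 2)) * hy

/-- `B2` marks where the two candidate values agree at `μ = 1`. -/
theorem sub_B2_eq {ξ s : ℝ} (hξ0 : 0 < ξ) (hsξ : s < ξ) :
    ∃ c > 0, s - B2 ξ = c * (s / ξ - (1 - √(ξ - s)) ^ 2) := by
  have hk0 : 0 < ξ - s := by linarith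
  have hx : √(ξ - s) ^ 2 = ξ - s := Real.sq_sqrt hk0.le
  have hx0 : 0 < √(ξ - s) := Real.sqrt_pos.2 hk0
  set x := √(ξ - s)
  have hs : s = ξ - x ^ 2 := by linarith
  refine ⟨(2 * ξ + x * (1 + ξ)) * ξ / ((1 + ξ) ^ 2 * x), by positivity, ?_⟩
  rw [hs, B2]
  field_simp
  ring

theorem sq_div_le {ξ s : ℝ} (hξ0 : 0 < ξ) (hsξ : s < ξ) (h : 2 * ξ ^ 2 ≤ ξ - s) :
    s ≤ ξ * (1 - √(2 * (ξ - s))) := by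
  have hk0 : 0 < ξ - s := by linarith
  have : √(2 * (ξ - s)) ≤ (ξ - s) / ξ := by
    rw [Real.sqrt_le_left (by positivity), div_pow, le_div_iff₀ (by positivity)]
    nlinarith
  rw [le_div_iff₀ hξ0] at this
  linarith

theorem thresholdValue_le_mul {ξ s μ : ℝ} (hξ0 : 0 < ξ) (hs0 : 0 ≤ s) (hsξ : s < ξ)
    (h : 2 * ξ ^ 2 ≤ ξ - s) (hμ : (1 + (1 - √(2 * (ξ - s)))) / 2 ≤ μ) :
    thresholdValue ξ s μ ≤ (1 - √(2 * (ξ - s))) * μ := by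
  rw [thresholdValue_of_ge hsξ h]
  have hk0 : 0 < ξ - s := by linarith
  have hsq : √(2 * (ξ - s)) ^ 2 = 2 * (ξ - s) := Real.sq_sqrt (by linarith)
  have hA0 : 0 < √(2 * (ξ - s)) := Real.sqrt_pos.2 (by linarith)
  have hAq := sq_div_le hξ0 hsξ h
  set r := s / ξ with hr
  have hr0 : 0 ≤ r := by positivity
  have hsr : s = r * ξ := by rw [hr]; field_simp
  set t := 1 - √(2 * (ξ - s)) with ht
  have hrt : r ≤ t := by rw [hr, div_le_iff₀ hξ0]; linarith
  have ht1 : t < 1 := by linarith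
  have hkt : 2 * (ξ - s) = (1 - t) ^ 2 := by rw [← hsq, ht]; ring
  have hkr : ξ - s = ξ * (1 - r) := by rw [hsr]; ring
  have hq : 0 < 1 - r := by linarith
  have e : 2 * ξ ^ 2 / (ξ - s) = (1 - t) ^ 2 / (1 - r) ^ 2 := by
    rw [← hkt, hkr]; field_simp
  rw [e]
  refine le_of_mul_le_mul_right (a := (1 - r) ^ 2) ?_ (by positivity)
  have e2 : r * (1 - (1 - t) ^ 2 / (1 - r) ^ 2 * (1 - μ)) * (1 - r) ^ 2 =
      r * ((1 - r) ^ 2 - (1 - t) ^ 2 * (1 - μ)) := by field_simp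
  rw [e2]
  -- After clearing denominators, the right side minus the left is `(t - r) * ((1 - r) ^ 2 - (1 - μ)
  -- * (1 - r * t))`.
  have h1 : (1 - μ) * (1 - r * t) ≤ (1 - r) ^ 2 := by
    have h2 : 2 * (1 - μ) ≤ 1 - r := by linarith
    have h3 : 1 - r * t ≤ 2 * (1 - r) := by nlinarith
    have h4 : 0 ≤ 1 - r * t := by nlinarith
    nlinarith [mul_le_mul_of_nonneg_right h2 h4, mul_le_mul_of_nonneg_left h3 hq.le]
  nlinarith [mul_nonneg (sub_nonneg.2 hrt) (sub_nonneg.2 h1)]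

section Regimes

variable {ξ s μ p : ℝ} {H : Measure ℝ}

theorem guarantee_le_max (hH : H ∈ meanDist μ) (hμ : μ ∈ Ioo (0 : ℝ) 1) (hξ0 : 0 < ξ)
    (hξ1 : ξ < 1) (hs0 : 0 ≤ s) (hsξ : s < ξ) (hp : 0 ≤ p) :
    revenueGuarantee ξ s p H ≤ max (uniformValue (ξ - s) μ) (thresholdValue ξ s μ) := by
  rcases le_or_gt p (s / ξ) with h | h
  · refine le_max_of_le_right ?_
    rcases le_total (ξ - s) (2 * ξ ^ 2) with hk | hk
    · rw [thresholdValue_of_le hsξ hk]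
      exact guarantee_le_of_price_le hH hξ0 hξ1 hs0 hsξ hp h hk
    · rw [thresholdValue_of_ge hsξ hk]
      exact guarantee_le_mixture_of_price_le hH hξ0 hs0 hsξ hp h hk
  · exact (guarantee_le_of_price_gt hH hμ hξ0 hξ1 hs0 hsξ h).trans
      (max_le_max_left _ (le_thresholdValue hξ0 hs0 hμ.2.le))

/-- For low priors `thresholdValue` can be too weak a bound when `2 * ξ ^ 2 < k`, because of its
positive intercept when `s > 0`. The bound with `A = √(2k)`, proportional to `μ`, replaces it. -/
theorem guarantee_le_uniformValue_of_le (hH : H ∈ meanDist μ) (hμ : μ ∈ Ioo (0 : ℝ) 1) (hξ0 : 0 < ξ)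
    (hξ1 : ξ < 1) (hs0 : 0 ≤ s) (hsξ : s < ξ) (hp : 0 ≤ p)
    (hlow : s / ξ < 1 - √(2 * (ξ - s) - (ξ - s) ^ 2))
    (hm : μ ≤ (1 + lowPrice (ξ - s)) / 2) :
    revenueGuarantee ξ s p H ≤ uniformValue (ξ - s) μ := by
  have hU : s / ξ * μ ≤ uniformValue (ξ - s) μ := by
    rw [uniformValue, if_pos hm, mul_comm]
    exact mul_le_mul_of_nonneg_left hlow.le hμ.1.le
  rcases le_or_gt p (s / ξ) with h | h
  · rcases le_total (ξ - s) (2 * ξ ^ 2) with hk | hk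
    · exact (guarantee_le_of_price_le hH hξ0 hξ1 hs0 hsξ hp h hk).trans hU
    · have hAq := sq_div_le hξ0 hsξ hk
      have hA0 : 0 < √(2 * (ξ - s)) := Real.sqrt_pos.2 (by linarith)
      have hr : s / ξ ≤ 1 - √(2 * (ξ - s)) := by rw [div_le_iff₀ hξ0]; linarith
      refine (guarantee_le_of_price_le_of_sq_eq hH hs0 hsξ hp hA0
        (by linarith [(by positivity : 0 ≤ s / ξ)]) (Real.sq_sqrt (by linarith)) hAq
        (h.trans hr)).trans ?_
      rw [uniformValue, if_pos hm, mul_comm]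
      exact mul_le_mul_of_nonneg_left
        (one_sub_sqrt_two_mul_lt (by linarith) (by linarith)).le hμ.1.le
  · exact (guarantee_le_of_price_gt hH hμ hξ0 hξ1 hs0 hsξ h).trans (max_le le_rfl hU)

/-- The strict gap at the left end of the concavity interval, from which the crossing argument
starts. -/
theorem thresholdValue_lt_uniformValue (hξ0 : 0 < ξ) (hξ1 : ξ < 1) (hs0 : 0 ≤ s) (hsξ : s < ξ)
    (hlow : s / ξ < 1 - √(2 * (ξ - s) - (ξ - s) ^ 2)) :
    thresholdValue ξ s ((1 + lowPrice (ξ - s)) / 2) <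
      uniformValue (ξ - s) ((1 + lowPrice (ξ - s)) / 2) := by
  have hk0 : 0 < ξ - s := by linarith
  have hk1 : ξ - s < 1 := by linarith
  have hpos := lowPrice_pos hk1
  have h1 := one_sub_sqrt_two_mul_lt hk0 hk1
  have h2 := lowPrice_mul_lt hk0 hk1
  rw [uniformValue, if_pos le_rfl, mul_comm]
  rcases le_total (ξ - s) (2 * ξ ^ 2) with hk | hk
  · rw [thresholdValue_of_le hsξ hk]
    exact mul_lt_mul_of_pos_right hlow (by linarith)
  · exact (thresholdValue_le_mul hξ0 hs0 hsξ hk (by linarith)).trans_lt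
      (mul_lt_mul_of_pos_right h1 (by linarith))

theorem uniformValue_le (hk0 : 0 < ξ - s) (hk1 : ξ - s < 1) (hμ : μ < 1) :
    uniformValue (ξ - s) μ ≤ (1 - √(2 * (ξ - s) - (ξ - s) ^ 2)) * μ := by
  rcases le_or_gt μ ((1 + lowPrice (ξ - s)) / 2) with hm | hm
  · rw [uniformValue, if_pos hm, mul_comm]
  · rw [uniformValue_of_ge hk0 hk1 hm.le]
    have hs0 : 0 < √(ξ - s) := Real.sqrt_pos.2 hk0
    have hpos := lowPrice_pos hk1
    have hlt := lowPrice_lt hk0 hk1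
    have h1 := min_le_left (2 * μ - 1) (1 - √(ξ - s))
    have h2 := min_le_right (2 * μ - 1) (1 - √(ξ - s))
    have h3 := linear_revenue_le (p := min (2 * μ - 1) (1 - √(ξ - s))) hk0 hk1
    have h4 := sqrt_two_mul_sub_lt_one hk1
    set x := min (2 * μ - 1) (1 - √(ξ - s))
    rw [flatRevenue, div_le_iff₀ (by linarith)]
    nlinarith [mul_nonneg (mul_nonneg (sub_nonneg.2 h4.le) (by linarith : 0 ≤ 1 - x))
      (by linarith : 0 ≤ 2 * μ - 1 - x)]

theorem concaveOn_uniformValue_sub (hξ1 : ξ < 1) (hs0 : 0 ≤ s) (hsξ : s < ξ) :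
    ConcaveOn ℝ (Icc ((1 + lowPrice (ξ - s)) / 2) 1)
      (fun μ => uniformValue (ξ - s) μ - thresholdValue ξ s μ) := by
  refine (uniformValue_concaveOn (by linarith) (by linarith)).sub
    ⟨convex_Icc _ _, fun x _ y _ a b _ _ hab => le_of_eq ?_⟩
  simp only [thresholdValue, smul_eq_mul]
  have hb : b = 1 - a := by linarith
  subst hb
  ring

theorem continuousOn_uniformValue_sub (hξ1 : ξ < 1) (hs0 : 0 ≤ s) (hsξ : s < ξ) :
    ContinuousOn (fun μ => uniformValue (ξ - s) μ - thresholdValue ξ s μ)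
      (Icc ((1 + lowPrice (ξ - s)) / 2) 1) := by
  refine (uniformValue_continuousOn (by linarith) (by linarith)).sub ?_
  unfold thresholdValue
  fun_prop

theorem thresholdValue_one : thresholdValue ξ s 1 = s / ξ := by simp [thresholdValue]

theorem fullOptimal_of_B1_le (hξ0 : 0 < ξ) (hξ1 : ξ < 1) (hs0 : 0 ≤ s) (hsξ : s < ξ)
    (h : B1 ξ ≤ s) (hμ : μ ∈ Ioo (0 : ℝ) 1) : FullOptimal ξ s μ := by
  obtain ⟨c, hc, hcs⟩ := sub_B1_eq hξ0 hsξ (by linarith)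
  have hlow : 1 - √(2 * (ξ - s) - (ξ - s) ^ 2) ≤ s / ξ := by
    by_contra hcon
    nlinarith [mul_pos hc (sub_pos.2 (not_le.1 hcon))]
  -- `B3 ≤ B1`, so mixture information plays no role here.
  have hk : ξ - s ≤ 2 * ξ ^ 2 := by
    have : ξ - 2 * ξ ^ 2 ≤ B1 ξ := by
      rw [B1, le_div_iff₀ (by positivity)]
      nlinarith [pow_pos hξ0 4]
    linarith
  refine fullOptimal_of_bound hμ hξ0 hξ1 hs0 hsξ fun p hp H hH =>
    (guarantee_le_max hH hμ hξ0 hξ1 hs0 hsξ hp.1).trans (max_le ?_ ?_)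
  · exact (uniformValue_le (by linarith) (by linarith) hμ.2).trans
      (mul_le_mul_of_nonneg_right hlow hμ.1.le)
  · rw [thresholdValue_of_le hsξ hk]

theorem uniformOptimal_of_thresholdValue_le (hξ0 : 0 < ξ) (hξ1 : ξ < 1) (hs0 : 0 ≤ s)
    (hsξ : s < ξ) (hlow : s / ξ < 1 - √(2 * (ξ - s) - (ξ - s) ^ 2)) (hμ : μ ∈ Ioo (0 : ℝ) 1)
    (h : (1 + lowPrice (ξ - s)) / 2 ≤ μ → thresholdValue ξ s μ ≤ uniformValue (ξ - s) μ) :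
    UniformOptimal ξ s μ := by
  refine uniformOptimal_of_bound hμ hξ0 hξ1 hs0 hsξ
    (hlow.trans (lowPrice_mul_lt (by linarith) (by linarith))) fun p hp H hH => ?_
  rcases le_total μ ((1 + lowPrice (ξ - s)) / 2) with hm | hm
  · exact guarantee_le_uniformValue_of_le hH hμ hξ0 hξ1 hs0 hsξ hp.1 hlow hm
  · exact (guarantee_le_max hH hμ hξ0 hξ1 hs0 hsξ hp.1).trans (max_le le_rfl (h hm))

theorem price_lt_of_lt_B1 (hξ0 : 0 < ξ) (hξ1 : ξ < 1) (hs0 : 0 ≤ s) (hsξ : s < ξ) (h : s < B1 ξ) :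
    s / ξ < 1 - √(2 * (ξ - s) - (ξ - s) ^ 2) := by
  obtain ⟨c, hc, hcs⟩ := sub_B1_eq hξ0 hsξ (by linarith)
  by_contra hcon
  nlinarith [mul_nonneg hc.le (sub_nonneg.2 (not_lt.1 hcon))]

theorem B2_le_B1 (hξ0 : 0 < ξ) : B2 ξ ≤ B1 ξ :=
  div_le_div_of_nonneg_left (by positivity) (by positivity) (by nlinarith)

/-- The concave difference of the candidates is positive at both ends of the interval, hence
throughout. -/
theorem uniformOptimal_of_lt_B2 (hξ0 : 0 < ξ) (hξ1 : ξ < 1) (hs0 : 0 ≤ s) (hsξ : s < ξ)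
    (h : s < B2 ξ) (hμ : μ ∈ Ioo (0 : ℝ) 1) : UniformOptimal ξ s μ := by
  have hlow := price_lt_of_lt_B1 hξ0 hξ1 hs0 hsξ (h.trans_le (B2_le_B1 hξ0))
  refine uniformOptimal_of_thresholdValue_le hξ0 hξ1 hs0 hsξ hlow hμ fun hm => ?_
  obtain ⟨c, hc, hcs⟩ := sub_B2_eq hξ0 hsξ
  have h1 : s / ξ < (1 - √(ξ - s)) ^ 2 := by
    by_contra hcon
    nlinarith [mul_nonneg hc.le (sub_nonneg.2 (not_lt.1 hcon))]
  have h0 := thresholdValue_lt_uniformValue hξ0 hξ1 hs0 hsξ hlow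
  have hm1 : (1 + lowPrice (ξ - s)) / 2 ≤ 1 := hm.trans hμ.2.le
  have := (concaveOn_uniformValue_sub hξ1 hs0 hsξ).min_le_of_mem_Icc
    (left_mem_Icc.2 hm1) (right_mem_Icc.2 hm1) ⟨hm, hμ.2.le⟩
  rw [uniformValue_one (by linarith) (by linarith), thresholdValue_one] at this
  have h2 := (lt_min (sub_pos.2 h0) (sub_pos.2 h1)).trans_le this
  linarith

/-- The threshold is the crossing point of the two candidates. It lies to the right of `(1 +
lowPrice k)/2`, hence of `(1 + s/ξ)/2`, the bound that mixture information needs in order to be a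
probability distribution. -/
theorem exists_prior_threshold (hξ0 : 0 < ξ) (hξ1 : ξ < 1) (hs0 : 0 ≤ s) (hsξ : s < ξ)
    (h2 : B2 ξ ≤ s) (h1 : s < B1 ξ) :
    ∃ t ∈ Ioc (0 : ℝ) 1, (1 + s / ξ) / 2 ≤ t ∧ (B2 ξ < s → t < 1) ∧ ∀ μ ∈ Ioo (0 : ℝ) 1,
      (μ < t → UniformOptimal ξ s μ) ∧
      (t ≤ μ → uniformValue (ξ - s) μ ≤ thresholdValue ξ s μ) := by
  have hlow := price_lt_of_lt_B1 hξ0 hξ1 hs0 hsξ h1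
  have hk0 : 0 < ξ - s := by linarith
  have hk1 : ξ - s < 1 := by linarith
  have hpos := lowPrice_pos hk1
  have hlt := lowPrice_lt hk0 hk1
  have hmul := lowPrice_mul_lt hk0 hk1
  have hsq := Real.sqrt_nonneg (ξ - s)
  obtain ⟨c, hc, hcs⟩ := sub_B2_eq hξ0 hsξ
  have h0 := thresholdValue_lt_uniformValue hξ0 hξ1 hs0 hsξ hlow
  obtain ⟨t, ht, hts, htl, htr⟩ := exists_crossing (by linarith)
    (concaveOn_uniformValue_sub hξ1 hs0 hsξ) (continuousOn_uniformValue_sub hξ1 hs0 hsξ)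
    (sub_pos.2 h0) (by
      rw [uniformValue_one hk0 hk1, thresholdValue_one]
      by_contra hcon
      nlinarith [mul_pos hc (not_le.1 hcon)])
  refine ⟨t, ⟨by linarith [ht.1], ht.2⟩, by linarith [ht.1], fun h => hts ?_, fun μ hμ =>
    ⟨fun h => ?_, fun h => ?_⟩⟩
  · rw [uniformValue_one hk0 hk1, thresholdValue_one]
    by_contra hcon
    nlinarith [mul_nonneg hc.le (not_lt.1 hcon)]
  · exact uniformOptimal_of_thresholdValue_le hξ0 hξ1 hs0 hsξ hlow hμ fun hm =>
      sub_nonneg.1 (htl μ ⟨hm, h.le⟩)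
  · exact sub_nonpos.1 (htr μ ⟨h, hμ.2.le⟩)

end Regimes

end RobustSelling

theorem theorem1 (ξ s : ℝ) (hξ0 : 0 < ξ) (hξ1 : ξ < 1) (hs0 : 0 ≤ s) (hsξ : s < ξ) :
    (RobustSelling.B1 ξ ≤ s →
      ∀ μ ∈ Set.Ioo (0 : ℝ) 1, RobustSelling.FullOptimal ξ s μ) ∧
    (s < RobustSelling.B2 ξ →
      ∀ μ ∈ Set.Ioo (0 : ℝ) 1, RobustSelling.UniformOptimal ξ s μ) ∧
    (RobustSelling.B2 ξ ≤ s → s < RobustSelling.B1 ξ →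
      (RobustSelling.B3 ξ ≤ s →
        ∃ μhat ∈ Set.Ioc (0 : ℝ) 1, (RobustSelling.B2 ξ < s → μhat < 1) ∧
          ∀ μ ∈ Set.Ioo (0 : ℝ) 1,
            (μ < μhat → RobustSelling.UniformOptimal ξ s μ) ∧
            (μhat ≤ μ → RobustSelling.FullOptimal ξ s μ)) ∧
      (s < RobustSelling.B3 ξ →
        ∃ μcheck ∈ Set.Ioc (0 : ℝ) 1, (RobustSelling.B2 ξ < s → μcheck < 1) ∧
          ∀ μ ∈ Set.Ioo (0 : ℝ) 1,
            (μ < μcheck → RobustSelling.UniformOptimal ξ s μ) ∧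
            (μcheck ≤ μ → RobustSelling.MixtureOptimal ξ s μ))) := by
  refine ⟨fun h μ hμ => RobustSelling.fullOptimal_of_B1_le hξ0 hξ1 hs0 hsξ h hμ,
    fun h μ hμ => RobustSelling.uniformOptimal_of_lt_B2 hξ0 hξ1 hs0 hsξ h hμ, fun h2 h1 => ?_⟩
  obtain ⟨t, ht, htm, ht1, hopt⟩ := RobustSelling.exists_prior_threshold hξ0 hξ1 hs0 hsξ h2 h1
  refine ⟨fun h3 => ⟨t, ht, ht1, fun μ hμ => ⟨(hopt μ hμ).1, fun htμ => ?_⟩⟩,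
    fun h3 => ⟨t, ht, ht1, fun μ hμ => ⟨(hopt μ hμ).1, fun htμ => ?_⟩⟩⟩
  · have hk : ξ - s ≤ 2 * ξ ^ 2 := by rw [RobustSelling.B3] at h3; linarith
    refine RobustSelling.fullOptimal_of_bound hμ hξ0 hξ1 hs0 hsξ fun p hp H hH => ?_
    refine (RobustSelling.guarantee_le_max hH hμ hξ0 hξ1 hs0 hsξ hp.1).trans ?_
    rw [max_eq_right ((hopt μ hμ).2 htμ), RobustSelling.thresholdValue_of_le hsξ hk]
  · have hk : 2 * ξ ^ 2 ≤ ξ - s := by rw [RobustSelling.B3] at h3; linarith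
    refine RobustSelling.mixtureOptimal_of_bound hμ hξ0 hξ1 hs0 hsξ (htm.trans htμ)
      fun p hp H hH => ?_
    refine (RobustSelling.guarantee_le_max hH hμ hξ0 hξ1 hs0 hsξ hp.1).trans ?_
    rw [max_eq_right ((hopt μ hμ).2 htμ), RobustSelling.thresholdValue_of_ge hsξ hk]
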